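/- Let $m\ge 1$ be an integer and let $\alpha\in\{0,1,2,3,4\}$. Let $\phi(x)\in\mathbb{Z}[x]$ be a monic polynomial which is irreducible modulo every prime $p\le m+\alpha$. Let $a_m$ be an integer and let $a_0(x),\dots,a_{m-1}(x)\in\mathbb{Z}[x]$ be polynomials (possibly zero) of degree less than $\deg\phi(x)$. Assume that the content of $a_m a_0(x)$ is not divisible by any prime $p\le m+\alpha$. Put $$b_j=\binom{m}{j}(m+\alpha)(m-1+\alpha)\cdots(j+1+\alpha)\qquad(0\le j\le m-1)$$ and $$L_{m,\alpha}^{\phi}(x)=\frac{1}{m!}\Bigl(a_m\phi(x)^m+\sum_{j=0}^{m-1}b_j\,a_j(x)\,\phi(x)^j\Bigr).$$ If $(m,\alpha)\notin\{(1,0),(2,2),(4,4),(6,4)\}$, then $L_{m,\alpha}^{\phi}(x)$ is irreducible over $\mathbb{Q}$. -/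

import Mathlib

open Polynomial

/-- The coefficient `b_j = binom(m, j) (m + α)(m - 1 + α) ⋯ (j + 1 + α)`. -/
def laguerreCoeff (m : ℕ) (α : ℚ) (j : ℕ) : ℚ :=
  (m.choose j : ℚ) * ∏ i ∈ Finset.Icc (j + 1) m, ((i : ℚ) + α)

/-- The generalized `φ`-Laguerre polynomial
`(1 / m!) (a_m φ(x)^m + ∑_{j < m} b_j a_j(x) φ(x)^j)` in `ℚ[x]`, where `am` is the integer `a_m`
and `a j` is the polynomial `a_j(x)`; only the values `a j` with `j < m` matter. -/
noncomputable def phiLaguerre (φ : ℤ[X]) (m : ℕ) (α : ℚ) (am : ℤ) (a : ℕ → ℤ[X]) : ℚ[X] :=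
  C ((1 : ℚ) / (m.factorial : ℚ)) *
    (C (am : ℚ) * (φ.map (Int.castRingHom ℚ)) ^ m +
      ∑ j ∈ Finset.range m,
        C (laguerreCoeff m α j) * (a j).map (Int.castRingHom ℚ) *
          (φ.map (Int.castRingHom ℚ)) ^ j)

/-! Clear the factor 1/m! to get an integer polynomial F. A prime dividing m + α divides every b_j
with j < m, so modulo it F is a constant times φ^m and every factor of F has degree k·deg φ for some
k (`natDegree_dvd_natDegree_of_mul`). For each k with 1 ≤ k ≤ m/2 this degree is excluded by a prime
p as in `IsExcludingPrime`: p divides b_j for j ≤ m - k, and the slopes of the φ-Newton polygon at p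
stay below 1/k. Suppose F = GH with deg G = k·deg φ. Then φ^(m-k+1) divides F modulo p, too much for
H alone, so φ divides G modulo p; the slopes force φ^(k+1) to divide G, too much for G. Polygons are
replaced by a lexicographic order on the monomials p^i φ^j, for which leading exponents add
(`HasLeading.mul`, `HasLeading.unique`).

The rest is the search for p. For k ≥ α, Sylvester's theorem (`exists_prime_gt_mod_lt`) supplies it,
and Bertrand's postulate covers m < 2k + α. Sylvester's theorem follows Erdős: if it failed,
binom(n, k) would have only prime factors up to k and be too small; tables settle bounded ranges.
For k < α ≤ 4 six pairs (α, k) remain: without an excluding prime, integers near m would have only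
tiny prime factors, and congruences rule this out except in the excluded cases. -/

/-! ### Leading monomials in p and φ -/

/-- The exponents `(i, j)` that come, in the lexicographic order on `(k * i + j, i)`, at or after
`(n, i₀)`. -/
def lexUpper (k n i₀ : ℕ) : Set (ℕ × ℕ) :=
  {e | n < k * e.1 + e.2 ∨ (n = k * e.1 + e.2 ∧ i₀ ≤ e.1)}

lemma mem_lexUpper {k n i₀ i j : ℕ} :
    (i, j) ∈ lexUpper k n i₀ ↔ n < k * i + j ∨ (n = k * i + j ∧ i₀ ≤ i) := Iff.rfl

/-- Weights and exponents of p both add. This and the next two lemmas place the three remainder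
terms of a product of leading expansions strictly after the product of the leading monomials. -/
lemma lexUpper_succ_add_mem {k i j i' j' : ℕ} :
    ∀ u ∈ lexUpper k (k * i + j) (i + 1), ∀ v ∈ lexUpper k (k * i' + j') (i' + 1),
      u + v ∈ lexUpper k (k * (i + i') + (j + j')) (i + i' + 1) := by
  rintro ⟨a, b⟩ hu ⟨c, d⟩ hv
  rw [mem_lexUpper] at hu hv
  rw [Prod.mk_add_mk, mem_lexUpper]
  simp only [mul_add]
  omega

lemma lexUpper_succ_add_singleton_mem {k i j i' j' : ℕ} :
    ∀ u ∈ lexUpper k (k * i + j) (i + 1), ∀ v ∈ ({(i', j')} : Set (ℕ × ℕ)),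
      u + v ∈ lexUpper k (k * (i + i') + (j + j')) (i + i' + 1) := by
  rintro ⟨a, b⟩ hu _ rfl
  rw [mem_lexUpper] at hu
  rw [Prod.mk_add_mk, mem_lexUpper]
  simp only [mul_add]
  omega

lemma singleton_add_lexUpper_succ_mem {k i j i' j' : ℕ} :
    ∀ u ∈ ({(i, j)} : Set (ℕ × ℕ)), ∀ v ∈ lexUpper k (k * i' + j') (i' + 1),
      u + v ∈ lexUpper k (k * (i + i') + (j + j')) (i + i' + 1) := by
  rintro _ rfl ⟨c, d⟩ hv
  rw [mem_lexUpper] at hv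
  rw [Prod.mk_add_mk, mem_lexUpper]
  simp only [mul_add]
  omega

/-- The ideal of `ℤ[X]` generated by the monomials `p ^ i * φ ^ j` with `(i, j) ∈ U`. -/
noncomputable def monomialSpan (p : ℕ) (φ : ℤ[X]) (U : Set (ℕ × ℕ)) : Ideal ℤ[X] :=
  Ideal.span (Set.image (fun e : ℕ × ℕ => (p : ℤ[X]) ^ e.1 * φ ^ e.2) U)

/-- Reduction of integer polynomials modulo `p`. -/
noncomputable abbrev redMod (p : ℕ) : ℤ[X] →+* (ZMod p)[X] := mapRingHom (Int.castRingHom (ZMod p))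

lemma redMod_eq_zero_iff (p : ℕ) (f : ℤ[X]) : redMod p f = 0 ↔ (p : ℤ[X]) ∣ f := by
  rw [show (p : ℤ[X]) = C (p : ℤ) by simp, C_dvd_iff_dvd_coeff, Polynomial.ext_iff]
  simp [ZMod.intCast_zmod_eq_zero_iff_dvd]

lemma redMod_natCast_self (p : ℕ) : redMod p (p : ℤ[X]) = 0 :=
  (redMod_eq_zero_iff p _).2 dvd_rfl

lemma prime_natCast_polynomial {p : ℕ} (hp : p.Prime) : Prime (p : ℤ[X]) := by
  rw [show (p : ℤ[X]) = C (p : ℤ) by simp, prime_C_iff]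
  exact Nat.prime_iff_prime_int.1 hp

section

variable {p : ℕ} {φ : ℤ[X]}

lemma mem_monomialSpan_of_mem {U : Set (ℕ × ℕ)} {i j : ℕ} (h : (i, j) ∈ U) (r : ℤ[X]) :
    r * ((p : ℤ[X]) ^ i * φ ^ j) ∈ monomialSpan p φ U :=
  Ideal.mul_mem_left _ _ (Ideal.subset_span ⟨(i, j), h, rfl⟩)

lemma monomialSpan_mono {U V : Set (ℕ × ℕ)} (h : U ⊆ V) : monomialSpan p φ U ≤ monomialSpan p φ V :=
  Ideal.span_mono (Set.image_mono h)

lemma monomialSpan_mul_mem {U V W : Set (ℕ × ℕ)} (h : ∀ u ∈ U, ∀ v ∈ V, u + v ∈ W) {f g : ℤ[X]}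
    (hf : f ∈ monomialSpan p φ U) (hg : g ∈ monomialSpan p φ V) :
    f * g ∈ monomialSpan p φ W := by
  have h1 : monomialSpan p φ U * monomialSpan p φ V ≤ monomialSpan p φ W := by
    rw [monomialSpan, monomialSpan, Ideal.span_mul_span', Ideal.span_le]
    rintro _ ⟨_, ⟨u, hu, rfl⟩, _, ⟨v, hv, rfl⟩, rfl⟩
    have := mem_monomialSpan_of_mem (p := p) (φ := φ) (i := (u + v).1) (j := (u + v).2)
      (h u hu v hv) 1
    have e : (p : ℤ[X]) ^ u.1 * φ ^ u.2 * ((p : ℤ[X]) ^ v.1 * φ ^ v.2) =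
        1 * ((p : ℤ[X]) ^ (u + v).1 * φ ^ (u + v).2) := by
      rw [Prod.fst_add, Prod.snd_add]
      ring
    change (p : ℤ[X]) ^ u.1 * φ ^ u.2 * ((p : ℤ[X]) ^ v.1 * φ ^ v.2) ∈ monomialSpan p φ W
    rwa [e]
  exact h1 (Ideal.mul_mem_mul hf hg)

/-- If `φ` does not divide `γ` modulo `p`, then `γ * p ^ i * φ ^ j` lies in no monomial ideal all of
whose generators have a bigger exponent of `p` or of `φ`. -/
lemma notMem_monomialSpan (hp : p.Prime) (hφ : redMod p φ ≠ 0) {γ : ℤ[X]}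
    (hγ : ¬ redMod p φ ∣ redMod p γ) {i j : ℕ} {U : Set (ℕ × ℕ)}
    (hU : ∀ e ∈ U, i < e.1 ∨ j < e.2) : γ * ((p : ℤ[X]) ^ i * φ ^ j) ∉ monomialSpan p φ U := by
  intro hmem
  have hP := prime_natCast_polynomial hp
  have hle : monomialSpan p φ U ≤ Ideal.span {(p : ℤ[X]) ^ (i + 1), φ ^ (j + 1)} := by
    rw [monomialSpan, Ideal.span_le]
    rintro _ ⟨e, he, rfl⟩
    rcases hU e he with h | h
    · exact Ideal.mul_mem_right _ _ (Ideal.mem_of_dvd _ (pow_dvd_pow _ h)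
        (Ideal.subset_span (by simp)))
    · exact Ideal.mul_mem_left _ _ (Ideal.mem_of_dvd _ (pow_dvd_pow _ h)
        (Ideal.subset_span (by simp)))
  obtain ⟨a, b, hab⟩ := Ideal.mem_span_pair.1 (hle hmem)
  have hφp : ¬ (p : ℤ[X]) ∣ φ := fun h => hφ ((redMod_eq_zero_iff p _).2 h)
  -- As p is prime in ℤ[X] and does not divide φ, one can cancel `p ^ i`, then `φ ^ j` modulo p,
  -- leaving φ ∣ γ modulo p.
  have hb : (p : ℤ[X]) ^ i ∣ b := by
    refine hP.pow_dvd_of_dvd_mul_right i (a := b) (b := φ ^ (j + 1))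
      (fun h => hφp (hP.dvd_of_dvd_pow h)) ?_
    refine ⟨γ * φ ^ j - a * p, ?_⟩
    linear_combination hab
  obtain ⟨b', rfl⟩ := hb
  have h1 : γ * φ ^ j = a * p + b' * φ ^ (j + 1) := by
    apply mul_left_cancel₀ (pow_ne_zero i hP.ne_zero)
    linear_combination -hab
  have h2 : (p : ℤ[X]) ∣ γ - b' * φ := by
    refine (hP.dvd_or_dvd (a := φ ^ j) ⟨a, by linear_combination h1⟩).resolve_left
      (fun h => hφp (hP.dvd_of_dvd_pow h))
  rw [← redMod_eq_zero_iff, map_sub, map_mul, sub_eq_zero] at h2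
  exact hγ ⟨_, h2.trans (mul_comm _ _)⟩

/-- `f` is `γ * p ^ i * φ ^ j` up to monomials after `(i, j)` in the lexicographic order, where `φ`
does not divide `γ` modulo `p`. -/
def HasLeading (p : ℕ) (φ : ℤ[X]) (k : ℕ) (f : ℤ[X]) (i j : ℕ) : Prop :=
  ∃ γ : ℤ[X], ¬ redMod p φ ∣ redMod p γ ∧
    f - γ * ((p : ℤ[X]) ^ i * φ ^ j) ∈ monomialSpan p φ (lexUpper k (k * i + j) (i + 1))

lemma HasLeading.mul {k : ℕ} (hφ : Prime (redMod p φ)) {f g : ℤ[X]} {i j i' j' : ℕ}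
    (hf : HasLeading p φ k f i j) (hg : HasLeading p φ k g i' j') :
    HasLeading p φ k (f * g) (i + i') (j + j') := by
  obtain ⟨γ, hγ, hf⟩ := hf
  obtain ⟨δ, hδ, hg⟩ := hg
  refine ⟨γ * δ, ?_, ?_⟩
  · rw [map_mul]
    exact fun h => (hφ.dvd_or_dvd h).elim hγ hδ
  have e : f * g - γ * δ * ((p : ℤ[X]) ^ (i + i') * φ ^ (j + j')) =
      (f - γ * ((p : ℤ[X]) ^ i * φ ^ j)) * (g - δ * ((p : ℤ[X]) ^ i' * φ ^ j')) +
      (f - γ * ((p : ℤ[X]) ^ i * φ ^ j)) * (δ * ((p : ℤ[X]) ^ i' * φ ^ j')) +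
      (γ * ((p : ℤ[X]) ^ i * φ ^ j)) * (g - δ * ((p : ℤ[X]) ^ i' * φ ^ j')) := by ring
  rw [e]
  exact add_mem (add_mem (monomialSpan_mul_mem lexUpper_succ_add_mem hf hg)
    (monomialSpan_mul_mem lexUpper_succ_add_singleton_mem hf (mem_monomialSpan_of_mem (Set.mem_singleton _) _)))
    (monomialSpan_mul_mem singleton_add_lexUpper_succ_mem (mem_monomialSpan_of_mem (Set.mem_singleton _) _) hg)

lemma HasLeading.unique {k : ℕ} (hp : p.Prime) (hφ : redMod p φ ≠ 0) {f : ℤ[X]} {i j i' j' : ℕ}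
    (h : HasLeading p φ k f i j) (h' : HasLeading p φ k f i' j') : i = i' ∧ j = j' := by
  -- If (i', j') came strictly after (i, j), then f, and with it the leading term at (i, j), would
  -- lie in the span of later monomials, against `notMem_monomialSpan`.
  have key : ∀ {i j i' j' : ℕ}, HasLeading p φ k f i j → HasLeading p φ k f i' j' →
      ¬ (i', j') ∈ lexUpper k (k * i + j) (i + 1) := by
    rintro i j i' j' ⟨γ, hγ, hf⟩ ⟨δ, hδ, hg⟩ hmem
    refine notMem_monomialSpan (U := lexUpper k (k * i + j) (i + 1)) hp hφ hγ
      (i := i) (j := j) ?_ ?_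
    · rintro ⟨a, b⟩ hab
      simp only [mem_lexUpper] at hab ⊢
      by_contra! hcon
      have := Nat.mul_le_mul_left k hcon.1
      omega
    · have h1 : f ∈ monomialSpan p φ (lexUpper k (k * i + j) (i + 1)) := by
        have h2 : f - δ * ((p : ℤ[X]) ^ i' * φ ^ j') ∈
            monomialSpan p φ (lexUpper k (k * i + j) (i + 1)) := by
          refine monomialSpan_mono ?_ hg
          rintro ⟨a, b⟩ hab
          simp only [mem_lexUpper] at hab hmem ⊢
          omega
        have := add_mem h2 (mem_monomialSpan_of_mem hmem δ)
        simpa using this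
      have := sub_mem h1 hf
      simpa using this
  have h1 := key h h'
  have h2 := key h' h
  simp only [mem_lexUpper] at h1 h2
  have : i = i' := by omega
  subst this
  omega

lemma redMod_pow_dvd_of_mem {k n i₀ : ℕ} {f : ℤ[X]}
    (hf : f ∈ monomialSpan p φ (lexUpper k n i₀)) : redMod p φ ^ n ∣ redMod p f := by
  have : monomialSpan p φ (lexUpper k n i₀) ≤
      (Ideal.span {redMod p φ ^ n}).comap (redMod p) := by
    rw [monomialSpan, Ideal.span_le]
    rintro _ ⟨⟨a, b⟩, hab, rfl⟩
    simp only [SetLike.mem_coe, Ideal.mem_comap, Ideal.mem_span_singleton, map_mul, map_pow,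
      redMod_natCast_self]
    rcases Nat.eq_zero_or_pos a with rfl | ha
    · simp only [mem_lexUpper] at hab
      exact Dvd.dvd.mul_left (pow_dvd_pow _ (by omega)) _
    · simp [zero_pow ha.ne']
  exact Ideal.mem_span_singleton.1 (this hf)

/-- Push f as far as possible along the order: maximise the weight n, bounded because `φ ^ n`
divides f modulo p, then the exponent i of p. The coefficient split off there is not divisible by φ
modulo p, since `γ = φ * q' + p * r` would move f one step further. -/
lemma exists_hasLeading {k : ℕ} {f : ℤ[X]}
    (hφ : 0 < (redMod p φ).natDegree) (hp : p.Prime) (hf : redMod p f ≠ 0) (hk : 0 < k) :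
    ∃ i j, HasLeading p φ k f i j := by
  classical
  have := Fact.mk hp
  set P : ℕ → ℕ → Prop := fun n i => f ∈ monomialSpan p φ (lexUpper k n i) with hP
  have hbound : ∀ n i, P n i → n ≤ (redMod p f).natDegree := by
    intro n i h
    have h1 := natDegree_le_of_dvd (redMod_pow_dvd_of_mem h) hf
    rw [natDegree_pow] at h1
    nlinarith
  have h0 : P 0 0 := by
    have := mem_monomialSpan_of_mem (p := p) (φ := φ) (U := lexUpper k 0 0) (i := 0) (j := 0)
      (by simp [lexUpper]) f
    simpa [hP] using this
  set n := Nat.findGreatest (fun n => P n 0) (redMod p f).natDegree with hn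
  have hn1 : P n 0 := Nat.findGreatest_spec (P := fun n => P n 0) (Nat.zero_le _) h0
  have hn2 : ¬ P (n + 1) 0 := by
    intro h
    have := Nat.le_findGreatest (P := fun n => P n 0) (hbound _ _ h) h
    omega
  have hstep : ∀ i, n < k * i → ¬ P n i := by
    intro i hi h
    refine hn2 (monomialSpan_mono ?_ h)
    rintro ⟨a, b⟩ hab
    simp only [mem_lexUpper] at hab ⊢
    rcases hab with h | ⟨h, h'⟩
    · omega
    · have := Nat.mul_le_mul_left k h'
      omega
  set i := Nat.findGreatest (P n) n with hi
  have hi1 : P n i := Nat.findGreatest_spec (P := P n) (Nat.zero_le _) hn1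
  have hi2 : ¬ P n (i + 1) := by
    intro h
    have h3 : i + 1 ≤ n := by
      by_contra h4
      exact hstep (i + 1) (by nlinarith) h
    have := Nat.le_findGreatest (P := P n) h3 h
    omega
  have hi3 : k * i ≤ n := by
    by_contra h
    exact hstep i (by omega) hi1
  obtain ⟨j, hj⟩ := Nat.exists_eq_add_of_le hi3
  have hsub : lexUpper k n i ⊆ insert (i, j) (lexUpper k n (i + 1)) := by
    rintro ⟨a, b⟩ hab
    simp only [mem_lexUpper, Set.mem_insert_iff, Prod.mk.injEq] at hab ⊢
    by_cases h : a = i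
    · subst h; omega
    · omega
  have h5 := monomialSpan_mono (p := p) (φ := φ) hsub hi1
  rw [monomialSpan, Set.image_insert_eq, Ideal.mem_span_insert] at h5
  obtain ⟨γ, z, hz, hfz⟩ := h5
  refine ⟨i, j, γ, ?_, ?_⟩
  · rintro ⟨q, hq⟩
    obtain ⟨q', rfl⟩ := map_surjective (Int.castRingHom (ZMod p)) (ZMod.ringHom_surjective _) q
    have h6 : redMod p (γ - φ * q') = 0 := by
      rw [map_sub, map_mul, hq, sub_eq_zero]
      rfl
    rw [redMod_eq_zero_iff] at h6
    obtain ⟨r, hr⟩ := h6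
    apply hi2
    have e : f = r * ((p : ℤ[X]) ^ (i + 1) * φ ^ j) + q' * ((p : ℤ[X]) ^ i * φ ^ (j + 1)) + z := by
      rw [hfz]
      simp only
      rw [show γ = φ * q' + p * r by rw [← hr]; ring]
      ring
    rw [hP]
    simp only
    rw [e]
    refine add_mem (add_mem (mem_monomialSpan_of_mem ?_ _) (mem_monomialSpan_of_mem ?_ _)) hz
    · simp only [mem_lexUpper, mul_add]
      omega
    · simp only [mem_lexUpper]
      omega
  · rw [← hj]
    have e : f - γ * ((p : ℤ[X]) ^ i * φ ^ j) = z := by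
      rw [hfz]
      ring
    rw [e]
    exact hz

/-- If the leading exponent of `G * H` is `(N, 0)` and `φ` divides `G` modulo `p`, then
`φ ^ (k + 1)` divides `G` modulo `p`. -/
theorem redMod_pow_succ_dvd_of_hasLeading_mul {k N : ℕ} (hp : p.Prime) (hφ : Irreducible (redMod p φ))
    (hk : 0 < k) {G H : ℤ[X]} (hGH : redMod p (G * H) ≠ 0) (hF : HasLeading p φ k (G * H) N 0)
    (hG : redMod p φ ∣ redMod p G) : redMod p φ ^ (k + 1) ∣ redMod p G := by
  have := Fact.mk hp
  rw [map_mul] at hGH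
  have hd := hφ.natDegree_pos
  obtain ⟨i, j, hlG⟩ := exists_hasLeading hd hp (left_ne_zero_of_mul hGH) hk
  obtain ⟨i', j', hlH⟩ := exists_hasLeading hd hp (right_ne_zero_of_mul hGH) hk
  obtain ⟨-, hj⟩ := (hlG.mul hφ.prime hlH).unique hp hφ.ne_zero hF
  obtain rfl : j = 0 := by omega
  obtain ⟨γ, hγ, hmem⟩ := hlG
  -- The leading monomial of G has no φ, so equal weight with a larger power of p is impossible: the
  -- remainder has weight at least k * i + 1.
  have h1 : monomialSpan p φ (lexUpper k (k * i + 0) (i + 1)) ≤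
      monomialSpan p φ (lexUpper k (k * i + 1) 0) := by
    refine monomialSpan_mono ?_
    rintro ⟨a, b⟩ hab
    simp only [mem_lexUpper] at hab ⊢
    rcases hab with h | ⟨h, h'⟩
    · omega
    · have := Nat.mul_le_mul_left k h'
      rw [mul_add] at this
      omega
  have h2 := redMod_pow_dvd_of_mem (h1 hmem)
  -- If i = 0, then G and γ agree modulo (p, φ), so φ would divide γ. If i ≥ 1, the leading term
  -- vanishes modulo p and the remainder has weight at least k + 1.
  rcases Nat.eq_zero_or_pos i with rfl | hi
  · exfalso
    simp only [pow_zero, mul_one, map_sub, mul_zero, zero_add, pow_one] at h2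
    exact hγ ((dvd_sub_right hG).1 h2)
  · rw [map_sub, map_mul, map_mul, map_pow, redMod_natCast_self, zero_pow hi.ne', zero_mul,
      mul_zero, sub_zero] at h2
    exact (pow_dvd_pow _ (by nlinarith)).trans h2

end

/-! ### Degrees of factors of φ-Laguerre polynomials -/

/-- The natural number `binom(m, j) (m + a)(m - 1 + a) ⋯ (j + 1 + a)`. -/
def natLaguerreCoeff (m a j : ℕ) : ℕ := m.choose j * ∏ i ∈ Finset.Icc (j + 1) m, (i + a)

lemma laguerreCoeff_natCast (m a j : ℕ) :
    laguerreCoeff m (a : ℚ) j = (natLaguerreCoeff m a j : ℚ) := by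
  simp [laguerreCoeff, natLaguerreCoeff]

lemma natLaguerreCoeff_self (m a : ℕ) : natLaguerreCoeff m a m = 1 := by
  simp [natLaguerreCoeff]

lemma natLaguerreCoeff_ne_zero {m a j : ℕ} (h : j ≤ m) : natLaguerreCoeff m a j ≠ 0 := by
  refine mul_ne_zero (Nat.choose_pos h).ne' (Finset.prod_ne_zero_iff.2 fun i hi => ?_)
  have := (Finset.mem_Icc.1 hi).1
  omega

/-- The integral polynomial `a_m φ ^ m + ∑_{j < m} b_j a_j φ ^ j`. -/
noncomputable def intLaguerre (φ : ℤ[X]) (m a : ℕ) (am : ℤ) (c : ℕ → ℤ[X]) : ℤ[X] :=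
  C am * φ ^ m + ∑ j ∈ Finset.range m, (natLaguerreCoeff m a j : ℤ[X]) * c j * φ ^ j

lemma phiLaguerre_natCast (φ : ℤ[X]) (m a : ℕ) (am : ℤ) (c : ℕ → ℤ[X]) :
    phiLaguerre φ m (a : ℚ) am c =
      C ((1 : ℚ) / (m.factorial : ℚ)) * (intLaguerre φ m a am c).map (Int.castRingHom ℚ) := by
  simp [phiLaguerre, intLaguerre, laguerreCoeff_natCast, Polynomial.map_sum]

/-- A prime that excludes factors of degree `k * φ.natDegree` of the `φ`-Laguerre polynomials. -/
structure IsExcludingPrime (m a k p : ℕ) : Prop where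
  prime : p.Prime
  le : p ≤ m + a
  dvd : ∀ j ≤ m - k, p ∣ natLaguerreCoeff m a j
  lt : ∀ j, 1 ≤ j → j ≤ m → k * (natLaguerreCoeff m a 0).factorization p <
    k * (natLaguerreCoeff m a j).factorization p + j

section

variable {φ : ℤ[X]} {m a : ℕ} {am : ℤ} {c : ℕ → ℤ[X]}

lemma degree_sum_lt_of_degree_lt (hφ : φ.Monic) (hc : ∀ j < m, (c j).degree < φ.degree) :
    (∑ j ∈ Finset.range m, (natLaguerreCoeff m a j : ℤ[X]) * c j * φ ^ j).degree <
      ((m * φ.natDegree : ℕ) : WithBot ℕ) := by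
  rw [← mem_degreeLT]
  refine Submodule.sum_mem _ fun j hj => ?_
  rw [Finset.mem_range] at hj
  rw [show (natLaguerreCoeff m a j : ℤ[X]) * c j * φ ^ j =
    (natLaguerreCoeff m a j : ℤ) • (c j * φ ^ j) by simp [mul_assoc]]
  refine Submodule.smul_mem _ _ ?_
  rw [mem_degreeLT]
  by_cases h0 : c j = 0
  · rw [h0, zero_mul, degree_zero]
    exact WithBot.bot_lt_coe _
  have h1 : c j * φ ^ j ≠ 0 := mul_ne_zero h0 (pow_ne_zero _ hφ.ne_zero)
  have h2 := natDegree_lt_natDegree h0 (hc j hj)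
  rw [degree_eq_natDegree h1, natDegree_mul h0 (pow_ne_zero _ hφ.ne_zero), natDegree_pow]
  have h3 : (j + 1) * φ.natDegree ≤ m * φ.natDegree := Nat.mul_le_mul_right _ hj
  rw [add_mul, one_mul] at h3
  exact Nat.cast_lt.2 (by omega)

lemma degree_C_mul_pow (hφ : φ.Monic) (ham : am ≠ 0) :
    (C am * φ ^ m).degree = ((m * φ.natDegree : ℕ) : WithBot ℕ) := by
  rw [degree_C_mul ham, degree_pow, degree_eq_natDegree hφ.ne_zero]
  simp

lemma natDegree_intLaguerre (hφ : φ.Monic) (hc : ∀ j < m, (c j).degree < φ.degree) (ham : am ≠ 0) :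
    (intLaguerre φ m a am c).natDegree = m * φ.natDegree := by
  apply natDegree_eq_of_degree_eq_some
  rw [intLaguerre, degree_add_eq_left_of_degree_lt, degree_C_mul_pow hφ ham]
  rw [degree_C_mul_pow hφ ham]
  exact degree_sum_lt_of_degree_lt hφ hc

lemma leadingCoeff_intLaguerre (hφ : φ.Monic) (hc : ∀ j < m, (c j).degree < φ.degree)
    (ham : am ≠ 0) : (intLaguerre φ m a am c).leadingCoeff = am := by
  rw [intLaguerre, leadingCoeff_add_of_degree_lt', leadingCoeff_mul, leadingCoeff_C,
    leadingCoeff_pow, hφ.leadingCoeff, one_pow, mul_one]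
  rw [degree_C_mul_pow hφ ham]
  exact degree_sum_lt_of_degree_lt hφ hc

lemma natDegree_redMod_of_dvd {p : ℕ} {am : ℤ} {G F : ℤ[X]} (hF : F.leadingCoeff = am)
    (ham : ¬ (p : ℤ) ∣ am) (hG : G ∣ F) : (redMod p G).natDegree = G.natDegree := by
  refine natDegree_map_of_leadingCoeff_ne_zero _ ?_
  have h1 : G.leadingCoeff ∣ am := hF ▸ leadingCoeff_dvd_leadingCoeff hG
  rw [eq_intCast, Ne, ZMod.intCast_zmod_eq_zero_iff_dvd]
  exact fun h => ham (h.trans h1)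

lemma redMod_natCast_eq_zero {p n : ℕ} (h : p ∣ n) : redMod p (n : ℤ[X]) = 0 := by
  rw [redMod_eq_zero_iff]
  exact_mod_cast Nat.cast_dvd_cast h

/-- The slope condition gives every term with j ≥ 1 a larger weight than the term j = 0. The
coefficient there is a unit modulo p times `c 0`, which is nonzero modulo p and of smaller degree
than φ. -/
lemma hasLeading_intLaguerre {p k : ℕ} (hp : p.Prime) (hφ : φ.Monic)
    (hirr : Irreducible (redMod p φ)) (hm : 1 ≤ m)
    (hc : ∀ j < m, (c j).degree < φ.degree) (hc0 : redMod p (c 0) ≠ 0)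
    (hlt : ∀ j, 1 ≤ j → j ≤ m → k * (natLaguerreCoeff m a 0).factorization p <
      k * (natLaguerreCoeff m a j).factorization p + j) :
    HasLeading p φ k (intLaguerre φ m a am c) ((natLaguerreCoeff m a 0).factorization p) 0 := by
  have := Fact.mk hp
  set b := natLaguerreCoeff m a with hb
  set N := (b 0).factorization p with hN
  have hfac : ∀ j, (b j : ℤ[X]) =
      (p : ℤ[X]) ^ (b j).factorization p * ((b j / p ^ (b j).factorization p : ℕ) : ℤ[X]) := by
    intro j
    exact_mod_cast (Nat.ordProj_mul_ordCompl_eq_self (b j) p).symm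
  have hterm : ∀ j, 1 ≤ j → j ≤ m → ∀ r : ℤ[X], (b j : ℤ[X]) * r * φ ^ j ∈
      monomialSpan p φ (lexUpper k (k * N + 0) (N + 1)) := by
    intro j h1 h2 r
    have h3 : (b j : ℤ[X]) * r * φ ^ j = (((b j / p ^ (b j).factorization p : ℕ) : ℤ[X]) * r) *
        ((p : ℤ[X]) ^ (b j).factorization p * φ ^ j) := by
      conv_lhs => rw [hfac j]
      ring
    rw [h3]
    exact mem_monomialSpan_of_mem (mem_lexUpper.2 (Or.inl (hlt j h1 h2))) _
  refine ⟨((b 0 / p ^ N : ℕ) : ℤ[X]) * c 0, ?_, ?_⟩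
  · rw [map_mul]
    intro h
    rcases hirr.prime.dvd_or_dvd h with h | h
    · have hne : ¬ p ∣ b 0 / p ^ N := Nat.not_dvd_ordCompl hp (natLaguerreCoeff_ne_zero (Nat.zero_le _))
      have h1 : IsUnit (redMod p ((b 0 / p ^ N : ℕ) : ℤ[X])) := by
        rw [map_natCast, show ((b 0 / p ^ N : ℕ) : (ZMod p)[X]) = C ((b 0 / p ^ N : ℕ) : ZMod p) by simp,
          isUnit_C, isUnit_iff_ne_zero, Ne, ZMod.natCast_eq_zero_iff]
        exact hne
      exact hirr.not_isUnit (isUnit_of_dvd_unit h h1)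
    · have h1 : (redMod p (c 0)).degree < (redMod p φ).degree := by
        have h2 : (redMod p φ).degree = φ.degree := hφ.degree_map _
        rw [h2]
        exact degree_map_le.trans_lt (hc 0 hm)
      exact hc0 (eq_zero_of_dvd_of_degree_lt h h1)
  -- As b_m = 1, the top term is treated like the others, with j = m.
  · have e : intLaguerre φ m a am c - ((b 0 / p ^ N : ℕ) : ℤ[X]) * c 0 * ((p : ℤ[X]) ^ N * φ ^ 0) =
        (b m : ℤ[X]) * C am * φ ^ m +
          ∑ j ∈ Finset.range (m - 1), (b (j + 1) : ℤ[X]) * c (j + 1) * φ ^ (j + 1) := by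
      obtain ⟨m', rfl⟩ := Nat.exists_eq_add_of_le' hm
      rw [intLaguerre, Finset.sum_range_succ', Nat.add_sub_cancel, ← hb]
      conv_lhs => rw [hfac 0, ← hN]
      rw [hb, natLaguerreCoeff_self]
      push_cast
      ring
    rw [e]
    refine add_mem (hterm m hm le_rfl _) (sum_mem fun j hj => hterm _ (by omega) ?_ _)
    rw [Finset.mem_range] at hj
    omega

lemma pow_dvd_redMod_intLaguerre {p k : ℕ} (hk : 1 ≤ k) (hkm : k ≤ m)
    (hdvd : ∀ j ≤ m - k, p ∣ natLaguerreCoeff m a j) :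
    redMod p φ ^ (m - k + 1) ∣ redMod p (intLaguerre φ m a am c) := by
  rw [intLaguerre, map_add, map_mul, map_pow, map_sum]
  refine dvd_add (Dvd.dvd.mul_left (pow_dvd_pow _ (by omega)) _) (Finset.dvd_sum fun j hj => ?_)
  rw [map_mul, map_mul, map_pow]
  by_cases h : j ≤ m - k
  · rw [redMod_natCast_eq_zero (hdvd j h)]
    simp
  · exact Dvd.dvd.mul_left (pow_dvd_pow _ (by omega)) _

/-- An excluding prime for `k` rules out factors of degree `k * φ.natDegree`. -/
theorem IsExcludingPrime.natDegree_ne {p k : ℕ} (h : IsExcludingPrime m a k p) (hφ : φ.Monic)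
    (hirr : Irreducible (redMod p φ)) (hk : 1 ≤ k) (hkm : k ≤ m)
    (hc : ∀ j < m, (c j).degree < φ.degree) (ham : ¬ (p : ℤ) ∣ am) (hc0 : redMod p (c 0) ≠ 0)
    {G H : ℤ[X]} (hGH : intLaguerre φ m a am c = G * H) : G.natDegree ≠ k * φ.natDegree := by
  intro hdeg
  have := Fact.mk h.prime
  have ham0 : am ≠ 0 := by
    rintro rfl
    exact ham (dvd_zero _)
  have hlc : (G * H).leadingCoeff = am := hGH ▸ leadingCoeff_intLaguerre hφ hc ham0
  have hnd : (G * H).natDegree = m * φ.natDegree := hGH ▸ natDegree_intLaguerre hφ hc ham0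
  have hG := natDegree_redMod_of_dvd hlc ham (dvd_mul_right G H)
  have hH := natDegree_redMod_of_dvd hlc ham (dvd_mul_left H G)
  have hφd : (redMod p φ).natDegree = φ.natDegree := hφ.natDegree_map _
  have hφpos := hirr.natDegree_pos
  have hne : redMod p (G * H) ≠ 0 := by
    intro h0
    have := natDegree_redMod_of_dvd hlc ham (dvd_refl (G * H))
    rw [h0, natDegree_zero, hnd] at this
    rw [hφd] at hφpos
    have : 0 < m * φ.natDegree := Nat.mul_pos (by omega) hφpos
    omega
  have hne' := hne
  rw [map_mul] at hne'
  have hG0 := left_ne_zero_of_mul hne'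
  have hH0 := right_ne_zero_of_mul hne'
  have hdegs : G.natDegree + H.natDegree = m * φ.natDegree := by
    rw [← hnd, natDegree_mul]
    · rintro rfl
      simp at hG0
    · rintro rfl
      simp at hH0
  -- Otherwise H would absorb `φ ^ (m - k + 1)`, although its degree is only (m - k)·deg φ.
  have hdvd : redMod p φ ∣ redMod p G := by
    by_contra hcon
    have h1 := pow_dvd_redMod_intLaguerre (φ := φ) (am := am) (c := c) hk hkm h.dvd
    rw [hGH, map_mul] at h1
    have h2 := hirr.prime.pow_dvd_of_dvd_mul_left _ hcon h1
    have h3 := natDegree_le_of_dvd h2 hH0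
    rw [natDegree_pow, hH, hφd] at h3
    rw [hφd] at hφpos
    have h4 : (m - k + 1 + k) * φ.natDegree ≤ m * φ.natDegree := by
      rw [add_mul, ← hdeg]
      omega
    have := Nat.le_of_mul_le_mul_right h4 hφpos
    omega
  have hlead := hasLeading_intLaguerre (am := am) h.prime hφ hirr (by omega) hc hc0 h.lt
  rw [hGH] at hlead
  have h5 := redMod_pow_succ_dvd_of_hasLeading_mul h.prime hirr hk hne hlead hdvd
  have h6 := natDegree_le_of_dvd h5 hG0
  rw [natDegree_pow, hG, hφd, hdeg] at h6
  rw [hφd] at hφpos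
  have := Nat.le_of_mul_le_mul_right h6 hφpos
  omega

lemma dvd_natLaguerreCoeff_of_dvd_add {p j : ℕ} (hp : p ∣ m + a) (hj : j < m) :
    p ∣ natLaguerreCoeff m a j :=
  Dvd.dvd.mul_left (hp.trans (Finset.dvd_prod_of_mem (fun i => i + a)
    (Finset.mem_Icc.2 ⟨hj, le_rfl⟩))) _

lemma natDegree_dvd_natDegree_of_mul {p : ℕ} (hp : p.Prime) (hpd : p ∣ m + a) (hφ : φ.Monic)
    (hirr : Irreducible (redMod p φ)) (hc : ∀ j < m, (c j).degree < φ.degree)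
    (ham : ¬ (p : ℤ) ∣ am) {G : ℤ[X]} (hG : G ∣ intLaguerre φ m a am c) :
    ∃ k, G.natDegree = k * φ.natDegree := by
  have := Fact.mk hp
  have ham0 : am ≠ 0 := by
    rintro rfl
    exact ham (dvd_zero _)
  have hGd := natDegree_redMod_of_dvd (leadingCoeff_intLaguerre (a := a) hφ hc ham0) ham hG
  have hred : redMod p (intLaguerre φ m a am c) = redMod p (C am) * redMod p φ ^ m := by
    rw [intLaguerre, map_add, map_mul, map_pow, map_sum, Finset.sum_eq_zero, add_zero]
    intro j hj
    rw [map_mul, map_mul, redMod_natCast_eq_zero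
      (dvd_natLaguerreCoeff_of_dvd_add hpd (Finset.mem_range.1 hj))]
    simp
  have hu : IsUnit (redMod p (C am)) := by
    rw [coe_mapRingHom, map_C, isUnit_C, isUnit_iff_ne_zero, eq_intCast, Ne,
      ZMod.intCast_zmod_eq_zero_iff_dvd]
    exact ham
  have h1 : redMod p G ∣ redMod p φ ^ m := by
    rw [← hu.dvd_mul_left, ← hred]
    exact map_dvd (redMod p) hG
  obtain ⟨k, -, hk⟩ := (dvd_prime_pow hirr.prime m).1 h1
  refine ⟨k, ?_⟩
  rw [← hGd, natDegree_eq_of_degree_eq (degree_eq_degree_of_associated hk), natDegree_pow]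
  congr 1
  exact hφ.natDegree_map _

/-- The `φ`-Laguerre polynomial is irreducible over `ℚ` as soon as each possible degree of a factor
is ruled out by some prime. -/
theorem irreducible_map_intLaguerre (hm : 1 ≤ m) (hma : 2 ≤ m + a) (hφ : φ.Monic)
    (hirr : ∀ p : ℕ, p.Prime → p ≤ m + a → Irreducible (redMod p φ))
    (hc : ∀ j < m, (c j).degree < φ.degree)
    (ham : ∀ p : ℕ, p.Prime → p ≤ m + a → ¬ (p : ℤ) ∣ am)
    (hc0 : ∀ p : ℕ, p.Prime → p ≤ m + a → redMod p (c 0) ≠ 0)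
    (hex : ∀ k, 1 ≤ k → 2 * k ≤ m → ∃ p, IsExcludingPrime m a k p) :
    Irreducible ((intLaguerre φ m a am c).map (Int.castRingHom ℚ)) := by
  set F := intLaguerre φ m a am c with hF
  obtain ⟨q, hq, hqd⟩ := Nat.exists_prime_and_dvd (show m + a ≠ 1 by omega)
  have hqle := Nat.le_of_dvd (by omega) hqd
  have := Fact.mk hq
  have hφpos : 0 < φ.natDegree := by
    have h1 := (hirr q hq hqle).natDegree_pos
    have h2 : (redMod q φ).natDegree = φ.natDegree := hφ.natDegree_map _
    omega
  have ham0 : am ≠ 0 := by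
    rintro rfl
    exact ham q hq hqle (dvd_zero _)
  have hnd : F.natDegree = m * φ.natDegree := natDegree_intLaguerre hφ hc ham0
  have hnpos : 0 < F.natDegree := hnd ▸ Nat.mul_pos hm hφpos
  have hF0 : F ≠ 0 := by
    intro h0
    rw [h0] at hnpos
    simp at hnpos
  have hsmall : ∀ G H : ℤ[X], F = G * H → 0 < G.natDegree → ¬ 2 * G.natDegree ≤ F.natDegree := by
    intro G H hGH hpos hle
    obtain ⟨k, hk⟩ := natDegree_dvd_natDegree_of_mul hq hqd hφ (hirr q hq hqle) hc
      (ham q hq hqle) (Dvd.intro H hGH.symm)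
    have hk1 : 1 ≤ k := by
      rcases Nat.eq_zero_or_pos k with rfl | h
      · omega
      · exact h
    have hk2 : 2 * k ≤ m := by
      rw [hnd, hk, ← mul_assoc] at hle
      exact Nat.le_of_mul_le_mul_right hle hφpos
    obtain ⟨p, hp⟩ := hex k hk1 hk2
    exact hp.natDegree_ne hφ (hirr p hp.prime hp.le) hk1 (by omega) hc (ham p hp.prime hp.le)
      (hc0 p hp.prime hp.le) hGH hk
  -- Constant factors of a primitive polynomial are units, so a proper factorization has two factors
  -- of positive degree, one of at most half the degree.
  have hprim : Irreducible F.primPart := by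
    refine ⟨fun hu => ?_, fun G H hGH => ?_⟩
    · have := natDegree_eq_zero_of_isUnit hu
      rw [natDegree_primPart] at this
      omega
    · have hunit : ∀ G : ℤ[X], G ∣ F.primPart → ¬ IsUnit G → 0 < G.natDegree := by
        intro G hG hnu
        by_contra h0
        obtain ⟨r, rfl⟩ := natDegree_eq_zero.1 (Nat.eq_zero_of_not_pos h0)
        have h1 := isPrimitive_of_dvd F.isPrimitive_primPart hG
        exact hnu (isUnit_C.2 (h1 r dvd_rfl))
      by_contra! hcon
      have hG := hunit G (Dvd.intro H hGH.symm) hcon.1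
      have hH := hunit H (Dvd.intro_left G hGH.symm) hcon.2
      have e1 : F = G * (C F.content * H) := by
        conv_lhs => rw [F.eq_C_content_mul_primPart, hGH]
        ring
      have e2 : F = H * (C F.content * G) := by
        conv_lhs => rw [F.eq_C_content_mul_primPart, hGH]
        ring
      have h1 := hsmall _ _ e1 hG
      have h2 := hsmall _ _ e2 hH
      have h3 : F.natDegree = G.natDegree + H.natDegree := by
        rw [← natDegree_primPart, hGH, natDegree_mul]
        · rintro rfl
          simp at hG
        · rintro rfl
          simp at hH
      omega
  rw [IsPrimitive.Int.irreducible_iff_irreducible_map_cast F.isPrimitive_primPart] at hprim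
  rw [F.eq_C_content_mul_primPart, Polynomial.map_mul, map_C]
  have hu : IsUnit (C ((Int.castRingHom ℚ) F.content)) := by
    rw [isUnit_C, isUnit_iff_ne_zero, eq_intCast]
    exact_mod_cast fun h => hF0 (content_eq_zero_iff.1 h)
  exact (irreducible_isUnit_mul hu).2 hprim

end

/-! ### Prime tables and prime counting -/

/-- Trial division of `p` by the odd numbers from `1009 - 2 * n` to `1007`, stopping at `√p`. -/
def noOddDivisor (p : ℕ) : ℕ → Bool
  | 0 => true
  | i + 1 => Nat.blt p ((1007 - 2 * i) * (1007 - 2 * i)) ||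
      (!Nat.beq (p % (1007 - 2 * i)) 0 && noOddDivisor p i)

lemma noOddDivisor_spec {p n : ℕ} (h : noOddDivisor p n = true) :
    ∀ i < n, (1007 - 2 * i) * (1007 - 2 * i) ≤ p → ¬ 1007 - 2 * i ∣ p := by
  induction n with
  | zero => simp
  | succ n ih =>
    rw [noOddDivisor, Bool.or_eq_true, Bool.and_eq_true, Nat.blt_eq, Bool.not_eq_true',
      ← Bool.not_eq_true, Nat.beq_eq] at h
    intro i hi hsq hd
    rcases h with h | h
    · have : 1007 - 2 * n ≤ 1007 - 2 * i := by omega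
      have := Nat.mul_le_mul this this
      omega
    · rcases Nat.lt_succ_iff_lt_or_eq.1 hi with hi | rfl
      · exact ih h.2 i hi hsq hd
      · exact h.1 (Nat.mod_eq_zero_of_dvd hd)

lemma prime_of_noOddDivisor {p : ℕ} (hodd : p % 2 = 1) (h1 : p ≠ 1) (hn : p < 1009 * 1009)
    (h : noOddDivisor p 503 = true) : p.Prime := by
  by_contra hp
  have h2 := Nat.minFac_sq_le_self (by omega) hp
  have h3 := Nat.minFac_prime h1
  have h4 := Nat.minFac_dvd p
  have h5 := h3.two_le
  have hodd' : p.minFac % 2 = 1 := by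
    by_contra h6
    have := (Nat.dvd_of_mod_eq_zero (show p.minFac % 2 = 0 by omega)).trans h4
    omega
  have h7 : p.minFac < 1009 := by nlinarith
  -- The 503 trial divisors are the odd numbers from 3 to 1007.
  obtain ⟨i, hi, hi'⟩ : ∃ i < 503, p.minFac = 1007 - 2 * i := ⟨(1007 - p.minFac) / 2, by omega, by omega⟩
  rw [hi'] at h2 h4
  exact noOddDivisor_spec h i hi (by rwa [← sq]) h4

/-- Each entry passes trial division, and the gap between neighbours `p` and `q` satisfies
`(q - p - 1) ^ 3 ≤ p ^ 2`. -/
def primeChainCheck : ℕ → List ℕ → Bool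
  | _, [] => true
  | p, q :: l => Nat.beq (p % 2) 1 && Nat.blt 1 p && Nat.blt p 1018081 && noOddDivisor p 503 &&
      Nat.ble ((q - p - 1) ^ 3) (p ^ 2) && primeChainCheck q l

/-- For neighbours p ≤ n < q the prime p serves, as n - p ≤ q - p - 1. The last entry only bounds
the range and is not tested. -/
lemma exists_prime_of_primeChainCheck {l : List ℕ} : ∀ {p : ℕ}, primeChainCheck p l = true →
    ∀ n, p ≤ n → n < (p :: l).getLast (by simp) → ∃ q, q.Prime ∧ q ≤ n ∧ (n - q) ^ 3 ≤ q ^ 2 := by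
  induction l with
  | nil =>
    intro p _ n h1 h2
    simp only [List.getLast_singleton] at h2
    omega
  | cons q l ih =>
    intro p h n h1 h2
    simp only [primeChainCheck, Bool.and_eq_true, Nat.blt_eq, Nat.beq_eq, Nat.ble_eq] at h
    obtain ⟨⟨⟨⟨⟨hodd, hone⟩, hlt⟩, hdiv⟩, hgap⟩, hrest⟩ := h
    by_cases hn : n < q
    · refine ⟨p, prime_of_noOddDivisor hodd (by omega) (by omega) hdiv, h1, ?_⟩
      exact (Nat.pow_le_pow_left (by omega) 3).trans hgap
    · rw [List.getLast_cons (by simp)] at h2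
      exact ih hrest n (by omega) h2

/-- A list of primes with small gaps. -/
def primeChain : List ℕ := [
    89, 109, 131, 157, 181, 211, 241, 277, 317, 359, 409, 463, 523, 587, 653, 727, 797, 883,
    971, 1069, 1171, 1283, 1399, 1523, 1637, 1759, 1901, 2053, 2213, 2383, 2557, 2741, 2927,
    3121, 3331, 3547, 3779, 4021, 4273, 4523, 4793, 5077, 5351, 5657, 5953, 6277, 6607, 6959,
    7321, 7699, 8089, 8467, 8867, 9293, 9733, 10181, 10651, 11131, 11621, 12119, 12647, 13187,
    13729, 14303, 14891, 15497, 16111, 16747, 17401, 18061, 18749, 19447, 20161, 20899, 21649,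
    22409, 23203, 24007, 24821, 25667, 26513, 27397, 28297, 29221, 30169, 31139, 32119, 33119,
    34147, 35171, 36241, 37337, 38453, 39581, 40739, 41911, 43117, 44293, 45541, 46817, 48109,
    49429, 50773, 52127, 53507, 54919, 56359, 57829, 59281, 60793, 62327, 63863, 65449, 67073,
    68713, 70381, 72077, 73783, 75541, 77323, 79133, 80963, 82813, 84713, 86629, 88547, 90533,
    92507, 94547, 96601, 98689, 100823, 102983, 105173, 107377, 109621, 111893, 114203, 116549,
    118931, 121349, 123791, 126271, 128767, 131317, 133877, 136483, 139133, 141811, 144511,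
    147263, 150041, 152857, 155707, 158597, 161527, 164477, 167471, 170509, 173573, 176677,
    179821, 182999, 186211, 189467, 192757, 196087, 199457, 202859, 206303, 209789, 213319,
    216877, 220471, 224113, 227797, 231503, 235273, 239081, 242927, 246817, 250751, 254713,
    258721, 262781, 266867, 271013, 275201, 279431, 283697, 288007, 292367, 296773, 301219,
    305663, 310187, 314761, 319387, 324053, 328753, 333517, 338323, 343177, 348077, 353021,
    357997, 363037, 368117, 373231, 378407, 383633, 388903, 394223, 399587, 405011, 410477,
    415999, 421559, 427181, 432847, 438569, 444341, 450161, 456023, 461933, 467903, 473929,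
    479971, 486091, 492257, 498469, 504727, 511061, 517417, 523847, 530339, 536891, 543497,
    550139, 556849, 563599, 570421, 577279, 584203, 591181, 598219, 605309, 612439, 619621,
    626887, 634211, 641581, 649007, 656483, 664019, 671609, 679279, 687007, 694789, 702623,
    710527, 718463, 726469, 734549, 742681, 750863, 759113, 767423, 775787, 784229, 792731,
    801293, 809917, 818603, 827347, 836161, 845027, 853949, 862943, 871993, 881119, 890303,
    899537, 908851, 918223, 927671, 937171, 946741, 956383, 966041, 975811, 985639, 995539,
    1005503]

lemma primeChainCheck_primeChain : primeChainCheck 73 primeChain = true := by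
  decide +kernel

lemma getLast_primeChain : (73 :: primeChain).getLast (by simp) = 1005503 := by
  decide +kernel

/-- The gap bound is shaped for Sylvester's theorem: together with n ^ 2 < k ^ 3 it gives n - q < k.
-/
lemma exists_prime_sub_pow_three_le {n : ℕ} (h1 : 73 ≤ n) (h2 : n < 1000000) :
    ∃ q, q.Prime ∧ q ≤ n ∧ (n - q) ^ 3 ≤ q ^ 2 :=
  exists_prime_of_primeChainCheck primeChainCheck_primeChain n h1
    (getLast_primeChain ▸ (by omega))

/-- Some `p` in the list satisfies `k < p` and `n % p < k`. -/
def hasLargePrime (k n : ℕ) : List ℕ → Bool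
  | [] => false
  | p :: l => (Nat.blt k p && Nat.blt (n % p) k) || hasLargePrime k n l

/-- The odd primes below `256`. -/
def primesBelow256 : List ℕ :=
  [251, 241, 239, 233, 229, 227, 223, 211, 199, 197, 193, 191, 181, 179, 173, 167, 163, 157, 151,
    149, 139, 137, 131, 127, 113, 109, 107, 103, 101, 97, 89, 83, 79, 73, 71, 67, 61, 59, 53, 47,
    43, 41, 37, 31, 29, 23, 19, 17, 13, 11, 7, 5, 3]

lemma exists_of_hasLargePrime {k n : ℕ} {l : List ℕ} (h : hasLargePrime k n l = true) :
    ∃ p ∈ l, k < p ∧ n % p < k := by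
  induction l with
  | nil => simp [hasLargePrime] at h
  | cons p l ih =>
    simp only [hasLargePrime, Bool.or_eq_true, Bool.and_eq_true, Nat.blt_eq] at h
    rcases h with h | h
    · exact ⟨p, by simp, h⟩
    · obtain ⟨q, hq, h⟩ := ih h
      exact ⟨q, by simp [hq], h⟩

lemma hasLargePrime_of_lt : ∀ k < 37, ∀ n < 256, 2 ≤ k → 2 * k ≤ n →
    hasLargePrime k n primesBelow256 = true := by
  decide +kernel

lemma prime_of_mem_primesBelow256 : ∀ p ∈ primesBelow256, p.Prime := by
  decide +kernel

/-- Beyond 30, primes lie in 8 of the 30 classes modulo 30, so π(k) ≤ 10 + 8((k - 30)/30 + 1), which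
is at most k/3 from k = 150 on. -/
lemma three_mul_primeCounting_le {k : ℕ} (hk : 37 ≤ k) : 3 * k.primeCounting ≤ k := by
  have small : ∀ k < 150, 37 ≤ k → 3 * k.primeCounting ≤ k := by decide +kernel
  by_cases h : k < 150
  · exact small k h hk
  · have h1 := Nat.primeCounting_add_le (a := 30) (k := 30) (by norm_num) le_rfl (k - 30)
    have h2 : Nat.primeCounting 30 = 10 := by decide +kernel
    have h3 : Nat.totient 30 = 8 := by decide +kernel
    rw [h2, h3, Nat.add_sub_cancel' (by omega)] at h1
    omega

lemma pow_self_le_pow_sub_primeCounting :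
    ∀ k < 37, 1 ≤ k → k.primeCounting ≤ k ∧ k ^ k ≤ 256 ^ (k - k.primeCounting) := by
  decide +kernel

/-! ### Bounds for binomial coefficients -/

section choose

lemma le_of_prime_dvd_choose {n k p : ℕ} (hkn : k ≤ n)
    (hno : ∀ p : ℕ, p.Prime → k < p → k ≤ n % p) (hp : p.Prime) (hd : p ∣ n.choose k) : p ≤ k := by
  by_contra! hlt
  have h1 : p ∣ n.descFactorial k := by
    rw [Nat.descFactorial_eq_factorial_mul_choose]
    exact hd.mul_left _
  rw [Nat.descFactorial_eq_prod_range, hp.prime.dvd_finsetProd_iff] at h1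
  obtain ⟨i, hi, h2⟩ := h1
  rw [Finset.mem_range] at hi
  have h3 := hno p hp hlt
  obtain ⟨c, hc⟩ := h2
  have h4 : n = i + p * c := by omega
  rw [h4, Nat.add_mul_mod_self_left, Nat.mod_eq_of_lt (by omega)] at h3
  omega

lemma choose_eq_prod_primeFactors {n k : ℕ} (hkn : k ≤ n) :
    n.choose k = ∏ p ∈ (n.choose k).primeFactors, p ^ (n.choose k).factorization p :=
  (Nat.prod_factorization_pow_eq_self (Nat.choose_pos hkn).ne').symm

lemma choose_le_pow_primeCounting {n k : ℕ} (hkn : k ≤ n) (hn : 0 < n)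
    (hno : ∀ p : ℕ, p.Prime → k < p → k ≤ n % p) : n.choose k ≤ n ^ k.primeCounting := by
  rw [choose_eq_prod_primeFactors hkn]
  refine (Finset.prod_le_pow_card _ _ n fun p _ => Nat.pow_factorization_choose_le hn).trans ?_
  refine Nat.pow_le_pow_right hn ?_
  rw [← Nat.primesLE_card_eq_primeCounting]
  refine Finset.card_le_card fun p hp => ?_
  have hp' := Nat.prime_of_mem_primeFactors hp
  exact Nat.mem_primesLE.2
    ⟨le_of_prime_dvd_choose hkn hno hp' (Nat.dvd_of_mem_primeFactors hp), hp'⟩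

/-- Primes up to √n contribute at most n each; larger ones occur to the first power and multiply to
at most the primorial of L. -/
lemma choose_le_pow_mul_four_pow {n k L : ℕ} (hkn : k ≤ n) (hn : 0 < n)
    (hL : ∀ p : ℕ, p.Prime → p ∣ n.choose k → n.sqrt < p → p ≤ L) :
    n.choose k ≤ n ^ n.sqrt.primeCounting * 4 ^ L := by
  conv_lhs => rw [choose_eq_prod_primeFactors hkn]
  rw [← Finset.prod_filter_mul_prod_filter_not _ (· ≤ n.sqrt)]
  refine Nat.mul_le_mul ?_ ?_
  · refine (Finset.prod_le_pow_card _ _ n fun p _ => Nat.pow_factorization_choose_le hn).trans ?_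
    refine Nat.pow_le_pow_right hn ?_
    rw [← Nat.primesLE_card_eq_primeCounting]
    refine Finset.card_le_card fun p hp => ?_
    rw [Finset.mem_filter] at hp
    exact Nat.mem_primesLE.2 ⟨hp.2, Nat.prime_of_mem_primeFactors hp.1⟩
  · refine le_trans ?_ (primorial_le_four_pow L)
    refine (Finset.prod_le_prod' fun p hp => (?_ : _ ≤ p)).trans ?_
    · rw [Finset.mem_filter, not_le] at hp
      refine (Nat.pow_le_pow_right (Nat.prime_of_mem_primeFactors hp.1).pos ?_).trans (pow_one p).le
      exact Nat.factorization_choose_le_one (Nat.sqrt_lt'.1 hp.2)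
    · rw [primorial_eq_prod_primesLE]
      refine Finset.prod_le_prod_of_subset_of_one_le' (fun p hp => ?_)
        (fun p hp _ => (Nat.prime_of_mem_primesLE hp).one_lt.le)
      rw [Finset.mem_filter, not_le] at hp
      have hp' := Nat.prime_of_mem_primeFactors hp.1
      exact Nat.mem_primesLE.2 ⟨hL p hp' (Nat.dvd_of_mem_primeFactors hp.1) hp.2, hp'⟩

/-- Factor by factor, (n - i)/(k - i) ≥ n/k, strictly at i = 1. -/
lemma pow_lt_choose_mul_pow {n k : ℕ} (hk : 2 ≤ k) (hkn : k < n) : n ^ k < n.choose k * k ^ k := by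
  have h1 : ∏ i ∈ Finset.range k, (n * (k - i)) < ∏ i ∈ Finset.range k, ((n - i) * k) := by
    refine Finset.prod_lt_prod (fun i hi => ?_) (fun i hi => ?_) ⟨1, by simp; omega, ?_⟩
    · rw [Finset.mem_range] at hi
      exact Nat.mul_pos (by omega) (by omega)
    · rw [Finset.mem_range] at hi
      zify [hi.le, (hi.trans hkn).le]
      nlinarith
    · zify [show 1 ≤ k by omega, show 1 ≤ n by omega]
      nlinarith
  rw [Finset.prod_mul_distrib, Finset.prod_mul_distrib, ← Nat.descFactorial_eq_prod_range,
    ← Nat.descFactorial_eq_prod_range, Finset.prod_const, Finset.prod_const, Finset.card_range,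
    Nat.descFactorial_self, Nat.descFactorial_eq_factorial_mul_choose] at h1
  refine Nat.lt_of_mul_lt_mul_right (a := k.factorial) ?_
  linarith

lemma choose_three_mul_succ (k : ℕ) : (k + 1) * (2 * k + 2) * (2 * k + 1) *
    (3 * (k + 1)).choose (k + 1) = (3 * k + 3) * (3 * k + 2) * (3 * k + 1) * (3 * k).choose k := by
  have h1 := Nat.choose_mul_factorial_mul_factorial (n := 3 * k) (k := k) (by omega)
  have h2 := Nat.choose_mul_factorial_mul_factorial (n := 3 * (k + 1)) (k := k + 1) (by omega)
  rw [show 3 * k - k = 2 * k by omega] at h1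
  rw [show 3 * (k + 1) - (k + 1) = 2 * k + 1 + 1 by omega,
    show (3 * (k + 1)).factorial = (3 * k + 1 + 1 + 1).factorial from rfl,
    Nat.factorial_succ (3 * k + 1 + 1), Nat.factorial_succ (3 * k + 1), Nat.factorial_succ (3 * k),
    Nat.factorial_succ k, Nat.factorial_succ (2 * k + 1), Nat.factorial_succ (2 * k), ← h1] at h2
  have h3 : 0 < k.factorial * (2 * k).factorial := by positivity
  refine Nat.eq_of_mul_eq_mul_right h3 ?_
  linarith

lemma four_mul_pow_le_choose_three_mul {k : ℕ} (hk : 1 ≤ k) :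
    4 * 27 ^ k ≤ 9 * k * 4 ^ k * (3 * k).choose k := by
  induction k, hk using Nat.le_induction with
  | base => decide
  | succ k hk ih =>
    have h := choose_three_mul_succ k
    have hpos : 0 < k * ((2 * k + 2) * (2 * k + 1)) := by positivity
    refine Nat.le_of_mul_le_mul_left ?_ hpos
    calc k * ((2 * k + 2) * (2 * k + 1)) * (4 * 27 ^ (k + 1))
        = (27 * (k * ((2 * k + 2) * (2 * k + 1)))) * (4 * 27 ^ k) := by ring
      _ ≤ (27 * (k * ((2 * k + 2) * (2 * k + 1)))) * (9 * k * 4 ^ k * (3 * k).choose k) :=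
          Nat.mul_le_mul_left _ ih
      _ = (27 * (k * ((2 * k + 2) * (2 * k + 1)))) * (k * (9 * 4 ^ k * (3 * k).choose k)) := by ring
      _ ≤ (4 * ((3 * k + 3) * (3 * k + 2) * (3 * k + 1))) * (k * (9 * 4 ^ k * (3 * k).choose k)) := by
          refine Nat.mul_le_mul_right _ ?_
          nlinarith
      _ = 9 * 4 ^ (k + 1) * k * ((3 * k + 3) * (3 * k + 2) * (3 * k + 1) * (3 * k).choose k) := by ring
      _ = 9 * 4 ^ (k + 1) * k *
            ((k + 1) * (2 * k + 2) * (2 * k + 1) * (3 * (k + 1)).choose (k + 1)) := by rw [h]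
      _ = _ := by ring

/-- Raising the upper index from N to N + 1 ≤ 3k multiplies the binomial by (N + 1)/(N + 1 - k) ≥
3/2. -/
lemma three_pow_mul_choose_le {k d : ℕ} (hd : d ≤ k) :
    3 ^ d * (2 * k).choose k ≤ 2 ^ d * (2 * k + d).choose k := by
  induction d with
  | zero => simp
  | succ d ih =>
    have h := Nat.choose_mul_succ_eq (2 * k + d) k
    have ih := ih (by omega)
    have hpos : 0 < 2 * k + d + 1 - k := by omega
    refine Nat.le_of_mul_le_mul_left ?_ hpos
    calc (2 * k + d + 1 - k) * (3 ^ (d + 1) * (2 * k).choose k)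
        = (3 * (2 * k + d + 1 - k)) * (3 ^ d * (2 * k).choose k) := by ring
      _ ≤ (3 * (2 * k + d + 1 - k)) * (2 ^ d * (2 * k + d).choose k) := Nat.mul_le_mul_left _ ih
      _ ≤ (2 * (2 * k + d + 1)) * (2 ^ d * (2 * k + d).choose k) := by
          refine Nat.mul_le_mul_right _ ?_
          omega
      _ = 2 ^ (d + 1) * ((2 * k + d).choose k * (2 * k + d + 1)) := by ring
      _ = 2 ^ (d + 1) * ((2 * k + d + 1).choose k * (2 * k + d + 1 - k)) := by rw [h]
      _ = _ := by rw [← add_assoc]; ring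

end choose

/-! ### Sylvester's theorem -/

lemma two_fifths_le_log_three_halves : (2 / 5 : ℝ) ≤ Real.log (3 / 2) := by
  rw [Real.le_log_iff_exp_le (by norm_num)]
  have h1 : Real.exp (2 / 5) ^ 5 = Real.exp 1 ^ 2 := by
    rw [← Real.exp_nat_mul, ← Real.exp_nat_mul]
    norm_num
  have h2 : Real.exp 1 ^ 2 ≤ (3 / 2) ^ 5 := by
    have := Real.exp_one_lt_d9
    have := Real.exp_pos 1
    nlinarith
  exact le_of_pow_le_pow_left₀ (by norm_num) (by norm_num) (h1.trans_le h2)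

lemma half_le_log : (1 / 2 : ℝ) ≤ Real.log (27 / 16) := by
  rw [Real.le_log_iff_exp_le (by norm_num)]
  have h1 : Real.exp (1 / 2) ^ 2 = Real.exp 1 := by
    rw [← Real.exp_nat_mul]
    norm_num
  have h2 : Real.exp 1 ≤ (27 / 16) ^ 2 := by
    have := Real.exp_one_lt_d9
    norm_num
    linarith
  exact le_of_pow_le_pow_left₀ (by norm_num) (by norm_num) (h1.trans_le h2)

/-- The tangent at 10, with log 10 ≤ 7/3; it is applied to k^(1/4) ≥ 10. -/
lemma log_le_div_ten_add {x : ℝ} (hx : 0 < x) : Real.log x ≤ x / 10 + 4 / 3 := by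
  have h1 : Real.log (x / 10) ≤ x / 10 - 1 := Real.log_le_sub_one_of_pos (by positivity)
  have h2 : Real.log (5 / 4) ≤ 5 / 4 - 1 := Real.log_le_sub_one_of_pos (by norm_num)
  have h3 : Real.log 10 = 3 * Real.log 2 + Real.log (5 / 4) := by
    rw [show (10 : ℝ) = 2 ^ 3 * (5 / 4) by norm_num, Real.log_mul (by norm_num) (by norm_num),
      Real.log_pow]
    norm_num
  rw [Real.log_div hx.ne' (by norm_num)] at h1
  have := Real.log_two_lt_d9
  linarith

/-- Up to a factor linear in k, binom(3k, k) is at least (27/4)^k, which beats 4^k by (27/16)^k ≥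
e^(k/2). With x = k^(1/4) one has √n ≤ x^3 and log n ≤ 6 log x, so the comparison becomes polynomial
in x. -/
lemma choose_gt_of_three_mul_le {n k : ℕ} (hk : 10000 ≤ k) (hn : 3 * k ≤ n) (hnk : n ^ 2 < k ^ 3) :
    n ^ n.sqrt.primeCounting * 4 ^ k < n.choose k := by
  by_contra! hcon
  have hs : 37 ≤ n.sqrt := Nat.le_sqrt.2 (by omega)
  have hpi := three_mul_primeCounting_le hs
  have h1 := four_mul_pow_le_choose_three_mul (k := k) (by omega)
  have h2 : (3 * k).choose k ≤ n.choose k := Nat.choose_le_choose k hn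
  have h3 : 4 * 27 ^ k ≤ 9 * k * 4 ^ k * (n ^ n.sqrt.primeCounting * 4 ^ k) :=
    h1.trans (Nat.mul_le_mul_left _ (h2.trans hcon))
  have hkR : (10000 : ℝ) ≤ k := by exact_mod_cast hk
  have hk0 : (0 : ℝ) < k := by linarith
  have hn0 : (0 : ℝ) < n := by
    have : 0 < n := by omega
    exact_mod_cast this
  set q := n.sqrt.primeCounting with hq
  have h4 : Real.log 4 + k * Real.log 27 ≤
      Real.log 9 + Real.log k + k * Real.log 4 + (q * Real.log n + k * Real.log 4) := by
    have h5 : (4 * 27 ^ k : ℝ) ≤ 9 * k * 4 ^ k * (n ^ q * 4 ^ k) := by exact_mod_cast h3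
    have h6 := Real.log_le_log (by positivity) h5
    rw [Real.log_mul (by positivity) (by positivity), Real.log_mul (by positivity) (by positivity),
      Real.log_mul (by positivity) (by positivity), Real.log_mul (by positivity) (by positivity),
      Real.log_mul (by positivity) (by positivity), Real.log_pow, Real.log_pow, Real.log_pow] at h6
    exact h6
  have h7 : Real.log (27 / 16) = Real.log 27 - 2 * Real.log 4 := by
    rw [Real.log_div (by norm_num) (by norm_num), show (16 : ℝ) = 4 ^ 2 by norm_num, Real.log_pow]
    norm_num
  have h8 : Real.log (9 / 4) = Real.log 9 - Real.log 4 :=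
    Real.log_div (by norm_num) (by norm_num)
  have h9 : Real.log (9 / 4) ≤ 9 / 4 - 1 := Real.log_le_sub_one_of_pos (by norm_num)
  set x : ℝ := √(√k) with hx
  have hx4 : x ^ 4 = k := by
    rw [show x ^ 4 = (x ^ 2) ^ 2 by ring, hx, Real.sq_sqrt (Real.sqrt_nonneg _),
      Real.sq_sqrt hk0.le]
  have hxpos : 0 < x := by positivity
  have hx10 : 10 ≤ x := by
    refine le_of_pow_le_pow_left₀ (n := 4) (by norm_num) hxpos.le ?_
    rw [hx4]
    linarith
  have hlogk : Real.log k = 4 * Real.log x := by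
    rw [← hx4, Real.log_pow]
    norm_num
  have hn2 : (n : ℝ) ^ 2 ≤ x ^ 12 := by
    rw [show x ^ 12 = (x ^ 4) ^ 3 by ring, hx4]
    exact_mod_cast hnk.le
  have hlogn : Real.log n ≤ 6 * Real.log x := by
    have := Real.log_le_log (by positivity) hn2
    rw [Real.log_pow, Real.log_pow] at this
    push_cast at this
    linarith
  have hsx : (n.sqrt : ℝ) ≤ x ^ 3 := by
    refine le_of_pow_le_pow_left₀ (n := 4) (by norm_num) (by positivity) ?_
    have h10 : (n.sqrt : ℝ) ^ 2 ≤ n := by exact_mod_cast Nat.sqrt_le' n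
    calc (n.sqrt : ℝ) ^ 4 = ((n.sqrt : ℝ) ^ 2) ^ 2 := by ring
      _ ≤ (n : ℝ) ^ 2 := by gcongr
      _ ≤ x ^ 12 := hn2
      _ = (x ^ 3) ^ 4 := by ring
  have hqx : (q : ℝ) ≤ x ^ 3 / 3 := by
    have : (3 * q : ℝ) ≤ n.sqrt := by exact_mod_cast hpi
    linarith
  have hlx : 0 ≤ Real.log x := Real.log_nonneg (by linarith)
  have hlx' := log_le_div_ten_add hxpos
  have h11 : q * Real.log n ≤ x ^ 3 / 3 * (6 * (x / 10 + 4 / 3)) := by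
    refine mul_le_mul hqx (by linarith) (Real.log_nonneg ?_) (by positivity)
    have : 1 ≤ n := by omega
    exact_mod_cast this
  have h12 : (k : ℝ) * (1 / 2) ≤ k * Real.log (27 / 16) :=
    mul_le_mul_of_nonneg_left half_le_log hk0.le
  have h13 : x ^ 4 * (1 / 2) ≤ x ^ 3 / 3 * (6 * (x / 10 + 4 / 3)) + 4 * (x / 10 + 4 / 3) + 5 / 4 := by
    rw [hx4]
    nlinarith
  have h14 : 1000 ≤ x ^ 3 := by nlinarith [sq_nonneg x]
  have h15 : x * 1000 ≤ x ^ 4 := by nlinarith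
  have h16 : 10 * x ^ 3 ≤ x ^ 4 := by nlinarith
  nlinarith

/-- For n = 2k + d the binomial exceeds 4^k (3/2)^d / k. The logarithmic gain over 4^(n/3) is at
least (k - d)/3 · log 4 + d log(3/2) - log k, where the first two terms give at least 2k/5 and log k
≤ k/50; π(√n) log n costs only 12k/33. -/
lemma choose_gt_of_lt_three_mul {n k : ℕ} (hk : 10000 ≤ k) (hn : 2 * k ≤ n) (hnk : n < 3 * k) :
    n ^ n.sqrt.primeCounting * 4 ^ (n / 3) < n.choose k := by
  by_contra! hcon
  have hs : 37 ≤ n.sqrt := Nat.le_sqrt.2 (by omega)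
  have hpi := three_mul_primeCounting_le hs
  obtain ⟨d, rfl⟩ := Nat.exists_eq_add_of_le hn
  set n := 2 * k + d with hnd
  have h1 := Nat.four_pow_lt_mul_centralBinom k (by omega)
  rw [Nat.centralBinom_eq_two_mul_choose] at h1
  have h2 := three_pow_mul_choose_le (k := k) (d := d) (by omega)
  set q := n.sqrt.primeCounting with hq
  have h3 : 4 ^ k * 3 ^ d ≤ k * (2 ^ d * (n ^ q * 4 ^ (n / 3))) := by
    calc 4 ^ k * 3 ^ d ≤ k * (2 * k).choose k * 3 ^ d := Nat.mul_le_mul_right _ h1.le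
      _ = k * (3 ^ d * (2 * k).choose k) := by ring
      _ ≤ _ := Nat.mul_le_mul_left _ (h2.trans (Nat.mul_le_mul_left _ hcon))
  have hkR : (10000 : ℝ) ≤ k := by exact_mod_cast hk
  have hk0 : (0 : ℝ) < k := by linarith
  have hnR : (n : ℝ) = 2 * k + d := by rw [hnd]; push_cast; ring
  have hn0 : (0 : ℝ) < n := by rw [hnR]; positivity
  have hdk : (d : ℝ) ≤ k := by
    have : d ≤ k := by omega
    exact_mod_cast this
  have h4 : k * Real.log 4 + d * Real.log 3 ≤
      Real.log k + (d * Real.log 2 + (q * Real.log n + (n / 3 : ℕ) * Real.log 4)) := by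
    have h5 : (4 ^ k * 3 ^ d : ℝ) ≤ k * (2 ^ d * (n ^ q * 4 ^ (n / 3))) := by exact_mod_cast h3
    have h6 := Real.log_le_log (by positivity) h5
    rw [Real.log_mul (by positivity) (by positivity), Real.log_mul (by positivity) (by positivity),
      Real.log_mul (by positivity) (by positivity), Real.log_mul (by positivity) (by positivity),
      Real.log_pow, Real.log_pow, Real.log_pow, Real.log_pow, Real.log_pow] at h6
    exact h6
  have hdiv : ((n / 3 : ℕ) : ℝ) ≤ n / 3 := Nat.cast_div_le
  have hlog4 : Real.log 4 = 2 * Real.log 2 := by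
    rw [show (4 : ℝ) = 2 ^ 2 by norm_num, Real.log_pow]
    norm_num
  have hlog2 := Real.log_two_gt_d9
  have hlog32 : Real.log (3 / 2) = Real.log 3 - Real.log 2 :=
    Real.log_div (by norm_num) (by norm_num)
  have h32 := two_fifths_le_log_three_halves
  have hlogk : Real.log k ≤ k / 50 := by
    have h5 : Real.log (√k) ≤ √k - 1 := Real.log_le_sub_one_of_pos (by positivity)
    rw [Real.log_sqrt hk0.le] at h5
    have h6 : √(k : ℝ) ^ 2 = k := Real.sq_sqrt hk0.le
    have h7 : 100 ≤ √(k : ℝ) := Real.le_sqrt_of_sq_le (by linarith)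
    nlinarith
  set y : ℝ := √(√n) with hy
  have hy4 : y ^ 4 = n := by
    rw [show y ^ 4 = (y ^ 2) ^ 2 by ring, hy, Real.sq_sqrt (Real.sqrt_nonneg _),
      Real.sq_sqrt hn0.le]
  have hypos : 0 < y := by positivity
  have hy11 : 11 ≤ y := by
    refine le_of_pow_le_pow_left₀ (n := 4) (by norm_num) hypos.le ?_
    rw [hy4, hnR]
    have : (0 : ℝ) ≤ d := by positivity
    linarith
  have hlogn : Real.log n ≤ 4 * y := by
    have h5 : Real.log y ≤ y - 1 := Real.log_le_sub_one_of_pos hypos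
    rw [← hy4, Real.log_pow]
    push_cast
    linarith
  have hsy : (n.sqrt : ℝ) ≤ y ^ 2 := by
    refine le_of_pow_le_pow_left₀ (n := 2) (by norm_num) (by positivity) ?_
    have h10 : (n.sqrt : ℝ) ^ 2 ≤ n := by exact_mod_cast Nat.sqrt_le' n
    calc (n.sqrt : ℝ) ^ 2 ≤ n := h10
      _ = (y ^ 2) ^ 2 := by rw [← hy4]; ring
  have hqy : (q : ℝ) ≤ y ^ 2 / 3 := by
    have : (3 * q : ℝ) ≤ n.sqrt := by exact_mod_cast hpi
    linarith
  have h11 : q * Real.log n ≤ y ^ 2 / 3 * (4 * y) := by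
    refine mul_le_mul hqy hlogn (Real.log_nonneg ?_) (by positivity)
    have : 1 ≤ n := by omega
    exact_mod_cast this
  have h12 : 11 * y ^ 3 ≤ y ^ 4 := by
    have : 0 < y ^ 3 := by positivity
    nlinarith
  have h13 : q * Real.log n ≤ 12 / 33 * k := by
    have : (n : ℝ) ≤ 3 * k := by exact_mod_cast hnk.le
    nlinarith
  have h14 : ((n / 3 : ℕ) : ℝ) * Real.log 4 ≤ n / 3 * Real.log 4 :=
    mul_le_mul_of_nonneg_right hdiv (by linarith)
  have h15 : (2 / 5 : ℝ) * (k - d) ≤ (k - d) / 3 * Real.log 4 := by nlinarith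
  have h16 : (2 / 5 : ℝ) * d ≤ d * Real.log (3 / 2) := by nlinarith [Nat.cast_nonneg (α := ℝ) d]
  rw [hnR] at h14
  nlinarith

/-- **Sylvester's theorem**: if `n ≥ 2 * k`, then one of the `k` consecutive integers ending
in `n` has a prime divisor greater than `k`. -/
theorem exists_prime_gt_mod_lt {n k : ℕ} (hk : 1 ≤ k) (hn : 2 * k ≤ n) :
    ∃ p : ℕ, p.Prime ∧ k < p ∧ n % p < k := by
  by_contra! hno
  have hkn : k ≤ n := by omega
  rcases eq_or_lt_of_le hk with rfl | hk2
  · have h1 := Nat.minFac_prime (n := n) (by omega)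
    have h2 := hno _ h1 h1.one_lt
    have h3 := Nat.mod_eq_zero_of_dvd (Nat.minFac_dvd n)
    omega
  have hup := choose_le_pow_primeCounting hkn (by omega) hno
  have hlow := pow_lt_choose_mul_pow hk2 (show k < n by omega)
  have hlt : n ^ k < n ^ k.primeCounting * k ^ k := hlow.trans_le (Nat.mul_le_mul_right _ hup)
  by_cases hk37 : k < 37
  · by_cases hn256 : n < 256
    · obtain ⟨p, hp, h1, h2⟩ := exists_of_hasLargePrime (hasLargePrime_of_lt k hk37 n hn256 hk2 hn)
      exact absurd (hno p (prime_of_mem_primesBelow256 p hp) h1) (by omega)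
    · obtain ⟨h1, h2⟩ := pow_self_le_pow_sub_primeCounting k hk37 hk
      have h3 : k ^ k ≤ n ^ (k - k.primeCounting) :=
        h2.trans (Nat.pow_le_pow_left (by omega) _)
      have h4 : n ^ k.primeCounting * k ^ k ≤ n ^ k := by
        calc _ ≤ n ^ k.primeCounting * n ^ (k - k.primeCounting) := Nat.mul_le_mul_left _ h3
          _ = n ^ k := by rw [← pow_add]; congr 1; omega
      omega
  have hpi := three_mul_primeCounting_le (show 37 ≤ k by omega)
  -- Cube `hlt` and use 3π(k) ≤ k.
  have hnk : n ^ 2 < k ^ 3 := by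
    by_contra! hcon
    have h1 : (n ^ k) ^ 3 < (n ^ k.primeCounting * k ^ k) ^ 3 := Nat.pow_lt_pow_left hlt (by norm_num)
    have h2 : (n ^ k.primeCounting * k ^ k) ^ 3 ≤ (n ^ k) ^ 3 := by
      calc (n ^ k.primeCounting * k ^ k) ^ 3 = n ^ (3 * k.primeCounting) * (k ^ 3) ^ k := by ring
        _ ≤ n ^ k * (n ^ 2) ^ k :=
          Nat.mul_le_mul (Nat.pow_le_pow_right (by omega) hpi) (Nat.pow_le_pow_left hcon _)
        _ = (n ^ k) ^ 3 := by ring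
    omega
  by_cases hkb : k < 10000
  · have hn6 : n < 1000000 := by
      by_contra! hcon
      have h1 : k ^ 3 ≤ 10000 ^ 3 := Nat.pow_le_pow_left hkb.le 3
      have h2 : 1000000 ^ 2 ≤ n ^ 2 := Nat.pow_le_pow_left hcon 2
      omega
    obtain ⟨q, hq, hqn, hgap⟩ := exists_prime_sub_pow_three_le (show 73 ≤ n by omega) hn6
    have h1 : (n - q) ^ 3 < k ^ 3 :=
      (hgap.trans (Nat.pow_le_pow_left hqn 2)).trans_lt hnk
    have h2 : n - q < k := lt_of_pow_lt_pow_left₀ 3 (by omega) h1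
    have h3 := hno q hq (by omega)
    rw [Nat.mod_eq_sub_mod hqn] at h3
    have := Nat.mod_le (n - q) q
    omega
  · by_cases hn3 : n < 3 * k
    · refine absurd (choose_le_pow_mul_four_pow hkn (by omega) (L := n / 3) fun p hp hd hs => ?_)
        (choose_gt_of_lt_three_mul (by omega) hn hn3).not_ge
      have hpk := le_of_prime_dvd_choose hkn hno hp hd
      -- A prime with n/3 < p ≤ k ≤ n/2 occurs twice in n! and once in each of k! and (n - k)!, so
      -- it cancels.
      by_contra! hcon
      have hp2 : p ≠ 2 := by omega
      have h1 := Nat.factorization_choose_of_lt_three_mul (n := n) hp2 hpk (by omega) (by omega)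
      have h2 := (hp.dvd_iff_one_le_factorization (Nat.choose_pos hkn).ne').1 hd
      omega
    · exact absurd (choose_le_pow_mul_four_pow hkn (by omega) (L := k)
        fun p hp hd _ => le_of_prime_dvd_choose hkn hno hp hd)
        (choose_gt_of_three_mul_le (by omega) (by omega) hnk).not_ge

/-! ### Valuations and excluding primes for k ≥ a -/

section valuation

variable {p : ℕ}

lemma factorization_factorial_div (hp : p.Prime) (n : ℕ) :
    n.factorial.factorization p = (n / p).factorial.factorization p + n / p := by
  have key : ∀ q r, r < p → (p * q + r).factorial.factorization p =
      q.factorial.factorization p + q := by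
    intro q r
    induction r with
    | zero => exact fun _ => Nat.factorization_factorial_mul hp
    | succ r ih =>
      intro hr
      have h1 : ¬ p ∣ p * q + r + 1 := by
        rw [add_assoc, Nat.dvd_add_right (dvd_mul_right p q)]
        exact Nat.not_dvd_of_pos_of_lt (by omega) hr
      rw [← add_assoc, Nat.factorial_succ, Nat.factorization_mul (by omega) (Nat.factorial_ne_zero _),
        Finsupp.add_apply, Nat.factorization_eq_zero_of_not_dvd h1, zero_add]
      exact ih (by omega)
  conv_lhs => rw [← Nat.div_add_mod n p]
  exact key _ _ (Nat.mod_lt _ hp.pos)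

lemma sub_one_mul_factorization_factorial_lt (hp : p.Prime) {n : ℕ} (hn : 1 ≤ n) :
    (p - 1) * n.factorial.factorization p + 1 ≤ n := by
  rw [Nat.sub_one_mul_factorization_factorial hp]
  have h1 : 0 < (p.digits n).sum := by
    by_contra h0
    have h3 : ∀ d ∈ p.digits n, d = 0 := by
      have : (p.digits n).sum = 0 := by omega
      exact List.sum_eq_zero_iff.1 this
    have h4 := Nat.getLast_digit_ne_zero p (m := n) (by omega)
    exact h4 (h3 _ (List.getLast_mem _))
  omega

lemma dvd_choose_of_mod_lt (hp : p.Prime) {m j : ℕ} (h : m % p < j % p) : p ∣ m.choose j := by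
  have := Fact.mk hp
  rw [(Choose.choose_modEq_choose_mod_mul_choose_div_nat (p := p) (n := m) (k := j)).dvd_iff dvd_rfl,
    Nat.choose_eq_zero_of_lt h, zero_mul]
  exact dvd_zero p

lemma dvd_choose_of_dvd_choose_div (hp : p.Prime) {m j : ℕ} (h : p ∣ (m / p).choose (j / p)) :
    p ∣ m.choose j := by
  have := Fact.mk hp
  rw [(Choose.choose_modEq_choose_mod_mul_choose_div_nat (p := p) (n := m) (k := j)).dvd_iff dvd_rfl]
  exact h.mul_left _

lemma one_le_factorization_choose (hp : p.Prime) {m j : ℕ} (hj : j ≤ m) (h : p ∣ m.choose j) :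
    1 ≤ (m.choose j).factorization p :=
  (hp.dvd_iff_one_le_factorization (Nat.choose_pos hj).ne').1 h

end valuation

section coefficients

variable {m a k p : ℕ}

lemma prod_Icc_mul_factorial {j : ℕ} (h : j ≤ m) :
    (∏ i ∈ Finset.Icc (j + 1) m, (i + a)) * (j + a).factorial = (m + a).factorial := by
  induction m, h using Nat.le_induction with
  | base => simp
  | succ m hm ih =>
    rw [Finset.prod_Icc_succ_top (by omega), mul_right_comm, ih, mul_comm,
      show m + 1 + a = m + a + 1 by omega, Nat.factorial_succ]

lemma factorization_natLaguerreCoeff {j : ℕ} (h : j ≤ m) :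
    (natLaguerreCoeff m a j).factorization p + (j + a).factorial.factorization p =
      (m.choose j).factorization p + (m + a).factorial.factorization p := by
  rw [← Finsupp.add_apply, ← Finsupp.add_apply,
    ← Nat.factorization_mul (natLaguerreCoeff_ne_zero h) (Nat.factorial_ne_zero _),
    ← Nat.factorization_mul (Nat.choose_pos h).ne' (Nat.factorial_ne_zero _),
    natLaguerreCoeff, mul_assoc, prod_Icc_mul_factorial h]

/-- If p ∣ m + a - i, this number is a factor of the product. If p ∣ m - i, then m % p = i: either j
% p > i and Lucas' theorem applies, or m - j ≥ p and the product runs over p consecutive integers.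
-/
lemma dvd_natLaguerreCoeff (hp : p.Prime) (hkp : k < p) (hkm : k ≤ m)
    (hd : ∃ i < k, p ∣ m - i ∨ p ∣ m + a - i) : ∀ j ≤ m - k, p ∣ natLaguerreCoeff m a j := by
  obtain ⟨i, hi, hd⟩ := hd
  intro j hj
  rcases hd with ⟨c, hc⟩ | hd
  · by_cases hlt : m % p < j % p
    · exact (dvd_choose_of_mod_lt hp hlt).mul_right _
    have hmi : m = i + p * c := by omega
    have hm : m % p = i := by rw [hmi, Nat.add_mul_mod_self_left, Nat.mod_eq_of_lt (by omega)]
    have hjd := Nat.div_add_mod j p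
    have hge : p ≤ m - j := by
      have h1 : j / p < c := by
        by_contra! hcon
        have := Nat.mul_le_mul_left p hcon
        omega
      have h2 := Nat.mul_le_mul_left p (Nat.succ_le_of_lt h1)
      rw [Nat.mul_succ] at h2
      omega
    have h3 := Nat.div_add_mod (m + a) p
    have h4 := Nat.mod_lt (m + a) hp.pos
    have h5 : p ∣ (p * ((m + a) / p) - a) + a := by
      rw [Nat.sub_add_cancel (by omega)]
      exact dvd_mul_right _ _
    exact Dvd.dvd.mul_left (h5.trans (Finset.dvd_prod_of_mem (fun i => i + a)
      (Finset.mem_Icc.2 ⟨by omega, by omega⟩))) _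
  · rw [show m + a - i = m - i + a by omega] at hd
    exact Dvd.dvd.mul_left (hd.trans (Finset.dvd_prod_of_mem (fun i => i + a)
      (Finset.mem_Icc.2 ⟨by omega, by omega⟩))) _

/-- In factorial form, v((m + a)!) cancels from v(b_0) - v(b_j), so m enters the slope condition
only through binom(m, j). -/
lemma isExcludingPrime_of_factorization (hp : p.Prime) (hkp : k < p) (hkm : k ≤ m)
    (hd : ∃ i < k, p ∣ m - i ∨ p ∣ m + a - i)
    (h : ∀ j, 1 ≤ j → j ≤ m → k * (j + a).factorial.factorization p <
      j + k * a.factorial.factorization p + k * (m.choose j).factorization p) :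
    IsExcludingPrime m a k p where
  prime := hp
  le := by
    obtain ⟨i, hi, hd | hd⟩ := hd
    · have := Nat.le_of_dvd (by omega) hd
      omega
    · have := Nat.le_of_dvd (by omega) hd
      omega
  dvd := dvd_natLaguerreCoeff hp hkp hkm hd
  lt := by
    intro j h1 h2
    have e0 := congrArg (k * ·) (factorization_natLaguerreCoeff (a := a) (p := p) (Nat.zero_le m))
    have ej := congrArg (k * ·) (factorization_natLaguerreCoeff (a := a) (p := p) h2)
    have h3 := h j h1 h2
    simp only [Nat.zero_add, Nat.choose_zero_right, Nat.factorization_one, Finsupp.coe_zero,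
      Pi.zero_apply, mul_add] at e0 ej
    omega

lemma isExcludingPrime_of_lt (hp : p.Prime) (hk : 1 ≤ k) (hkp : k + a < p) (hkm : k ≤ m)
    (hd : ∃ i < k, p ∣ m - i ∨ p ∣ m + a - i) : IsExcludingPrime m a k p := by
  refine isExcludingPrime_of_factorization hp (by omega) hkm hd fun j h1 h2 => ?_
  rw [add_assoc]
  refine Nat.lt_add_right _ ?_
  by_cases hlt : j + a < p
  · rw [Nat.factorization_factorial_eq_zero_of_lt hlt]
    omega
  · have h3 := sub_one_mul_factorization_factorial_lt hp (show 1 ≤ j + a by omega)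
    by_contra! hcon
    set v := (j + a).factorial.factorization p
    have h4 : (k + a) * v + 1 ≤ j + a :=
      le_trans (by gcongr; omega) h3
    have h5 : k + 1 ≤ j := by omega
    nlinarith

/-- The case `k ≥ a`. -/
lemma exists_isExcludingPrime_of_le (hk : 1 ≤ k) (hkm : 2 * k ≤ m) (ha : a ≤ k) :
    ∃ p, IsExcludingPrime m a k p := by
  by_cases h : 2 * k + a ≤ m
  -- The k + a integers ending in m + a start at m - k + 1. As a ≤ k, they are covered by the k
  -- integers ending in m and the k ending in m + a.
  · obtain ⟨p, hp, hlt, hmod⟩ := exists_prime_gt_mod_lt (n := m + a) (k := k + a) (by omega) (by omega)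
    refine ⟨p, isExcludingPrime_of_lt hp hk hlt (by omega) ?_⟩
    have hd : p ∣ m + a - (m + a) % p := Nat.dvd_sub_mod _
    by_cases hr : (m + a) % p < k
    · exact ⟨_, hr, Or.inr hd⟩
    · refine ⟨(m + a) % p - a, by omega, Or.inl ?_⟩
      rwa [show m - ((m + a) % p - a) = m + a - (m + a) % p by omega]
  -- Here m < 2k + a. A Bertrand prime p has 2p > m + a, so v((j + a)!) ≤ 1; in the only bad case, j
  -- ≤ k and p ≤ j + a, it divides binom(m, j).
  · obtain ⟨p, hp, h1, h2⟩ := Nat.exists_prime_lt_and_le_two_mul ((m + a) / 2) (by omega)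
    refine ⟨p, isExcludingPrime_of_factorization hp (by omega) (by omega) ?_ fun j hj1 hj2 => ?_⟩
    · by_cases hr : p ≤ m
      · exact ⟨m - p, by omega, Or.inl (by rw [Nat.sub_sub_self hr])⟩
      · exact ⟨m + a - p, by omega, Or.inr (by rw [Nat.sub_sub_self (by omega)])⟩
    · rw [factorization_factorial_div hp, add_assoc]
      have h3 : (j + a) / p ≤ 1 := Nat.lt_succ_iff.1 (Nat.div_lt_of_lt_mul (by omega))
      rcases Nat.le_one_iff_eq_zero_or_eq_one.1 h3 with h4 | h4
      · rw [h4]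
        simp
        omega
      · rw [h4]
        simp only [Nat.factorial_one, Nat.factorization_one, Finsupp.coe_zero, Pi.zero_apply]
        by_cases hjk : k < j
        · omega
        · have hpj : p ≤ j + a := by
            by_contra hcon
            rw [Nat.div_eq_of_lt (by omega)] at h4
            omega
          have hC : p ∣ m.choose j := by
            have h5 : p ∣ m.choose j * j.factorial * (m - j).factorial := by
              rw [Nat.choose_mul_factorial_mul_factorial hj2]
              exact hp.dvd_factorial.2 (by omega)
            rcases hp.dvd_mul.1 h5 with h5 | h5
            · rcases hp.dvd_mul.1 h5 with h5 | h5
              · exact h5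
              · have := hp.dvd_factorial.1 h5
                omega
            · have := hp.dvd_factorial.1 h5
              omega
          have := Nat.mul_le_mul_left k (one_le_factorization_choose hp hj2 hC)
          omega

end coefficients

/-! ### Excluding primes p ≤ k + a -/

section smallPrimes

variable {m : ℕ}

lemma factorization_choose_of_mod_lt {p : ℕ} (hp : p.Prime) {j : ℕ} (hj : j ≤ m) :
    m % p < j % p → 1 ≤ (m.choose j).factorization p :=
  fun h => one_le_factorization_choose hp hj (dvd_choose_of_mod_lt hp h)

lemma factorization_choose_of_div_mod_lt {p : ℕ} (hp : p.Prime) {j : ℕ} (hj : j ≤ m) :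
    m / p % p < j / p % p → 1 ≤ (m.choose j).factorization p :=
  fun h => one_le_factorization_choose hp hj
    (dvd_choose_of_dvd_choose_div hp (dvd_choose_of_mod_lt hp h))

lemma factorization_factorial_two : (Nat.factorial 2).factorization 2 = 1 := by
  rw [factorization_factorial_div Nat.prime_two]
  simp

lemma factorization_factorial_four : (Nat.factorial 4).factorization 2 = 3 := by
  rw [factorization_factorial_div Nat.prime_two, show 4 / 2 = 2 from rfl,
    factorization_factorial_two]

lemma factorization_factorial_three_three : (Nat.factorial 3).factorization 3 = 1 := by
  rw [factorization_factorial_div Nat.prime_three]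
  simp

lemma factorization_factorial_four_three : (Nat.factorial 4).factorization 3 = 1 := by
  rw [factorization_factorial_div Nat.prime_three]
  simp

lemma isExcludingPrime_two_one_three (hm : 1 ≤ m) (h : m % 3 = 0) : IsExcludingPrime m 2 1 3 := by
  have hp := Nat.prime_three
  refine isExcludingPrime_of_factorization hp (by omega) (by omega)
    ⟨0, by omega, Or.inl (by omega)⟩ fun j h1 h2 => ?_
  have b1 := sub_one_mul_factorization_factorial_lt hp (show 1 ≤ j + 2 by omega)
  have hC := factorization_choose_of_mod_lt hp h2
  omega

/-- By Legendre's digit-sum formula, only j + 2 = 2^s with s ≥ 2 needs help from the binomial. The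
second binary digit of such j is 1 and that of m is 0, so Lucas makes binom(m, j) even. -/
lemma isExcludingPrime_two_one_two (hm : 1 ≤ m) (h : m % 4 = 0) : IsExcludingPrime m 2 1 2 := by
  have hp := Nat.prime_two
  refine isExcludingPrime_of_factorization hp (by omega) (by omega)
    ⟨0, by omega, Or.inl (by omega)⟩ fun j h1 h2 => ?_
  have s1 := factorization_factorial_div hp (j + 2)
  have s2 := factorization_factorial_div hp ((j + 2) / 2)
  have b1 := sub_one_mul_factorization_factorial_lt hp (n := (j + 2) / 2)
  have b2 := sub_one_mul_factorization_factorial_lt hp (n := (j + 2) / 2 / 2)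
  have a1 := factorization_factorial_two
  have hC := factorization_choose_of_div_mod_lt hp h2
  omega

lemma isExcludingPrime_three_one_three (hm : 1 ≤ m) (h : m % 3 = 0) : IsExcludingPrime m 3 1 3 := by
  have hp := Nat.prime_three
  refine isExcludingPrime_of_factorization hp (by omega) (by omega)
    ⟨0, by omega, Or.inl (by omega)⟩ fun j h1 h2 => ?_
  have b1 := sub_one_mul_factorization_factorial_lt hp (show 1 ≤ j + 3 by omega)
  have a1 := factorization_factorial_three_three
  omega

lemma isExcludingPrime_four_one_three (hm : 1 ≤ m) (h : m % 3 = 0 ∨ m % 3 = 2) :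
    IsExcludingPrime m 4 1 3 := by
  have hp := Nat.prime_three
  refine isExcludingPrime_of_factorization hp (by omega) (by omega)
    ⟨0, by omega, by omega⟩ fun j h1 h2 => ?_
  have s1 := factorization_factorial_div hp (j + 4)
  have b0 := sub_one_mul_factorization_factorial_lt hp (show 1 ≤ j + 4 by omega)
  have b1 := sub_one_mul_factorization_factorial_lt hp (n := (j + 4) / 3)
  have a1 := factorization_factorial_four_three
  omega

lemma isExcludingPrime_four_one_five (hm : 1 ≤ m) (h : m % 5 = 0) : IsExcludingPrime m 4 1 5 := by
  have hp := Nat.prime_five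
  refine isExcludingPrime_of_factorization hp (by omega) (by omega)
    ⟨0, by omega, Or.inl (by omega)⟩ fun j h1 h2 => ?_
  have b1 := sub_one_mul_factorization_factorial_lt hp (show 1 ≤ j + 4 by omega)
  have hC := factorization_choose_of_mod_lt hp h2
  omega

lemma isExcludingPrime_four_one_two (hm : 1 ≤ m) (h : m % 8 = 0) : IsExcludingPrime m 4 1 2 := by
  have hp := Nat.prime_two
  refine isExcludingPrime_of_factorization hp (by omega) (by omega)
    ⟨0, by omega, Or.inl (by omega)⟩ fun j h1 h2 => ?_
  have s1 := factorization_factorial_div hp (j + 4)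
  have s2 := factorization_factorial_div hp ((j + 4) / 2)
  have s3 := factorization_factorial_div hp ((j + 4) / 2 / 2)
  have b1 := sub_one_mul_factorization_factorial_lt hp (n := (j + 4) / 2)
  have b2 := sub_one_mul_factorization_factorial_lt hp (n := (j + 4) / 2 / 2)
  have b3 := sub_one_mul_factorization_factorial_lt hp (n := (j + 4) / 2 / 2 / 2)
  have a1 := factorization_factorial_four
  have hC : m / 2 / 2 % 2 < j / 2 / 2 % 2 → 1 ≤ (m.choose j).factorization 2 := fun h =>
    one_le_factorization_choose hp h2 (dvd_choose_of_dvd_choose_div hp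
      (dvd_choose_of_dvd_choose_div hp (dvd_choose_of_mod_lt hp h)))
  omega

lemma isExcludingPrime_three_two_five (hm : 2 ≤ m) (h : m % 5 ≤ 1) : IsExcludingPrime m 3 2 5 := by
  have hp := Nat.prime_five
  refine isExcludingPrime_of_factorization hp (by omega) (by omega)
    ⟨m % 5, by omega, Or.inl (by omega)⟩ fun j h1 h2 => ?_
  have b1 := sub_one_mul_factorization_factorial_lt hp (show 1 ≤ j + 3 by omega)
  have hC := factorization_choose_of_mod_lt hp h2
  omega

lemma isExcludingPrime_three_two_three (hm : 2 ≤ m) (h : m % 9 ≤ 1) : IsExcludingPrime m 3 2 3 := by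
  have hp := Nat.prime_three
  refine isExcludingPrime_of_factorization hp (by omega) (by omega)
    ⟨m % 9, by omega, Or.inl (by omega)⟩ fun j h1 h2 => ?_
  have s1 := factorization_factorial_div hp (j + 3)
  have s2 := factorization_factorial_div hp ((j + 3) / 3)
  have b1 := sub_one_mul_factorization_factorial_lt hp (n := (j + 3) / 3)
  have b2 := sub_one_mul_factorization_factorial_lt hp (n := (j + 3) / 3 / 3)
  have a1 := factorization_factorial_three_three
  have hC := factorization_choose_of_div_mod_lt hp h2
  have z : ((j + 3) / 3 / 3 = 0 → (Nat.factorial ((j + 3) / 3 / 3)).factorization 3 = 0) := by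
    intro h0
    rw [h0]
    simp
  omega

lemma isExcludingPrime_four_two_five (hm : 2 ≤ m) (h : m % 5 = 0) : IsExcludingPrime m 4 2 5 := by
  have hp := Nat.prime_five
  refine isExcludingPrime_of_factorization hp (by omega) (by omega)
    ⟨0, by omega, Or.inl (by omega)⟩ fun j h1 h2 => ?_
  have b1 := sub_one_mul_factorization_factorial_lt hp (show 1 ≤ j + 4 by omega)
  have hC := factorization_choose_of_mod_lt hp h2
  omega

/-- Trouble needs ternary digit sum at most 2 for j + 4; then one of the two lowest ternary digits
of j is 2, while those of m are at most 1. -/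
lemma isExcludingPrime_four_two_three (hm : 2 ≤ m) (h : m % 3 ≤ 1) (h' : m / 3 % 3 ≤ 1) :
    IsExcludingPrime m 4 2 3 := by
  have hp := Nat.prime_three
  refine isExcludingPrime_of_factorization hp (by omega) (by omega)
    ⟨m % 3, by omega, Or.inl (by omega)⟩ fun j h1 h2 => ?_
  have s1 := factorization_factorial_div hp (j + 4)
  have s2 := factorization_factorial_div hp ((j + 4) / 3)
  have b1 := sub_one_mul_factorization_factorial_lt hp (n := (j + 4) / 3)
  have b2 := sub_one_mul_factorization_factorial_lt hp (n := (j + 4) / 3 / 3)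
  have a1 := factorization_factorial_four_three
  have hC := factorization_choose_of_mod_lt hp h2
  have hC' := factorization_choose_of_div_mod_lt hp h2
  have z : ((j + 4) / 3 / 3 = 0 → (Nat.factorial ((j + 4) / 3 / 3)).factorization 3 = 0) := by
    intro h0
    rw [h0]
    simp
  omega

lemma isExcludingPrime_four_three_seven (hm : 3 ≤ m) (h : m % 7 ≤ 2) : IsExcludingPrime m 4 3 7 := by
  have hp := Nat.prime_seven
  refine isExcludingPrime_of_factorization hp (by omega) (by omega)
    ⟨m % 7, by omega, Or.inl (by omega)⟩ fun j h1 h2 => ?_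
  have b1 := sub_one_mul_factorization_factorial_lt hp (show 1 ≤ j + 4 by omega)
  have hC := factorization_choose_of_mod_lt hp h2
  omega

lemma isExcludingPrime_four_three_five (hm : 3 ≤ m) (h : m % 5 = 0) : IsExcludingPrime m 4 3 5 := by
  have hp := Nat.prime_five
  refine isExcludingPrime_of_factorization hp (by omega) (by omega)
    ⟨0, by omega, Or.inl (by omega)⟩ fun j h1 h2 => ?_
  have s1 := factorization_factorial_div hp (j + 4)
  have b0 := sub_one_mul_factorization_factorial_lt hp (show 1 ≤ j + 4 by omega)
  have b1 := sub_one_mul_factorization_factorial_lt hp (n := (j + 4) / 5)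
  have hC := factorization_choose_of_mod_lt hp h2
  omega

end smallPrimes

/-! ### The six pairs with k < a -/

section smooth

lemma exists_eq_pow_of_forall_prime {n q : ℕ} (hn : n ≠ 0) (h : ∀ p : ℕ, p.Prime → p ∣ n → p = q) :
    ∃ t, n = q ^ t :=
  ⟨_, Nat.eq_prime_pow_of_unique_prime_dvd hn fun {d} hd hdn => h d hd hdn⟩

lemma two_pow_lt_or_mod_eight (t : ℕ) : 2 ^ t = 1 ∨ 2 ^ t = 2 ∨ 2 ^ t = 4 ∨ 2 ^ t % 8 = 0 := by
  rcases t with _ | _ | _ | t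
  · simp
  · simp
  · simp
  · right; right; right
    rw [pow_add]
    omega

lemma three_pow_lt_or_mod_nine (t : ℕ) : 3 ^ t = 1 ∨ 3 ^ t = 3 ∨ 3 ^ t % 9 = 0 := by
  rcases t with _ | _ | t
  · simp
  · simp
  · right; right
    rw [pow_add]
    omega

lemma five_pow_mod (t : ℕ) : 5 ^ t % 24 = 1 ∨ 5 ^ t % 24 = 5 := by
  induction t with
  | zero => simp
  | succ t ih => rw [pow_succ]; omega

lemma prime_le_seven_cases {p : ℕ} (hp : p.Prime) (h : p ≤ 7) : p = 2 ∨ p = 3 ∨ p = 5 ∨ p = 7 := by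
  have := hp.two_le
  interval_cases p <;> first | omega | (exfalso; revert hp; decide)

lemma prime_le_seven_cases_of_not {m a k p i : ℕ} (hno : ∀ p, ¬ IsExcludingPrime m a k p)
    (hk : 1 ≤ k) (hkm : k ≤ m) (hka : k + a ≤ 7) (hp : p.Prime) (hi : i < k)
    (hd : p ∣ m - i ∨ p ∣ m + a - i) : p ≤ k + a ∧ (p = 2 ∨ p = 3 ∨ p = 5 ∨ p = 7) := by
  have h1 : p ≤ k + a := by
    by_contra! h
    exact hno p (isExcludingPrime_of_lt hp hk h hkm ⟨i, hi, hd⟩)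
  exact ⟨h1, prime_le_seven_cases hp (h1.trans hka)⟩

end smooth

section smallCases

variable {m : ℕ}

lemma exists_isExcludingPrime_two_one (hm : 3 ≤ m) : ∃ p, IsExcludingPrime m 2 1 p := by
  by_contra! hno
  have h3 : m % 3 ≠ 0 := fun h => hno 3 (isExcludingPrime_two_one_three (by omega) h)
  have h4 : m % 4 ≠ 0 := fun h => hno 2 (isExcludingPrime_two_one_two (by omega) h)
  obtain ⟨t, ht⟩ : ∃ t, m = 2 ^ t := by
    refine exists_eq_pow_of_forall_prime (by omega) fun p hp hd => ?_
    obtain ⟨h1, rfl | rfl | rfl | rfl⟩ := prime_le_seven_cases_of_not hno le_rfl (by omega)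
      (by omega) hp (i := 0) (by omega) (Or.inl hd) <;> omega
  have := two_pow_lt_or_mod_eight t
  omega

lemma exists_isExcludingPrime_three_one (hm : 2 ≤ m) : ∃ p, IsExcludingPrime m 3 1 p := by
  by_contra! hno
  have h3 : m % 3 ≠ 0 := fun h => hno 3 (isExcludingPrime_three_one_three (by omega) h)
  have h1 : m % 2 = 0 := by
    obtain ⟨p, hp, hd⟩ := Nat.exists_prime_and_dvd (show m ≠ 1 by omega)
    obtain ⟨h1, rfl | rfl | rfl | rfl⟩ := prime_le_seven_cases_of_not hno le_rfl (by omega)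
      (by omega) hp (i := 0) (by omega) (Or.inl hd) <;> omega
  -- m + 3 is odd and prime to 3, yet its prime factors are at most 4.
  obtain ⟨p, hp, hd⟩ := Nat.exists_prime_and_dvd (show m + 3 ≠ 1 by omega)
  obtain ⟨h1, rfl | rfl | rfl | rfl⟩ := prime_le_seven_cases_of_not hno le_rfl (by omega)
    (by omega) hp (i := 0) (by omega) (Or.inr hd) <;> omega

lemma exists_isExcludingPrime_four_one (hm : 2 ≤ m) (hm4 : m ≠ 4) :
    ∃ p, IsExcludingPrime m 4 1 p := by
  by_contra! hno
  have h3 : ¬ (m % 3 = 0 ∨ m % 3 = 2) :=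
    fun h => hno 3 (isExcludingPrime_four_one_three (by omega) h)
  have h5 : m % 5 ≠ 0 := fun h => hno 5 (isExcludingPrime_four_one_five (by omega) h)
  have h8 : m % 8 ≠ 0 := fun h => hno 2 (isExcludingPrime_four_one_two (by omega) h)
  obtain ⟨t, ht⟩ : ∃ t, m = 2 ^ t := by
    refine exists_eq_pow_of_forall_prime (by omega) fun p hp hd => ?_
    obtain ⟨h1, rfl | rfl | rfl | rfl⟩ := prime_le_seven_cases_of_not hno le_rfl (by omega)
      (by omega) hp (i := 0) (by omega) (Or.inl hd) <;> omega
  have := two_pow_lt_or_mod_eight t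
  omega

lemma exists_isExcludingPrime_three_two (hm : 4 ≤ m) : ∃ p, IsExcludingPrime m 3 2 p := by
  by_contra! hno
  have h5 : ¬ m % 5 ≤ 1 := fun h => hno 5 (isExcludingPrime_three_two_five (by omega) h)
  have h9 : ¬ m % 9 ≤ 1 := fun h => hno 3 (isExcludingPrime_three_two_three (by omega) h)
  have h0 : ∀ p : ℕ, p.Prime → p ∣ m → p = 2 ∨ p = 3 := by
    intro p hp hd
    obtain ⟨h1, rfl | rfl | rfl | rfl⟩ := prime_le_seven_cases_of_not hno (by omega) (by omega)
      (by omega) hp (i := 0) (by omega) (Or.inl hd) <;> omega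
  have h1 : ∀ p : ℕ, p.Prime → p ∣ m - 1 → p = 2 ∨ p = 3 := by
    intro p hp hd
    obtain ⟨h1, rfl | rfl | rfl | rfl⟩ := prime_le_seven_cases_of_not hno (by omega) (by omega)
      (by omega) hp (i := 1) (by omega) (Or.inl hd) <;> omega
  rcases Nat.mod_two_eq_zero_or_one m with hpar | hpar
  · obtain ⟨t, ht⟩ : ∃ t, m - 1 = 3 ^ t := by
      refine exists_eq_pow_of_forall_prime (by omega) fun p hp hd => ?_
      obtain rfl | rfl := h1 p hp hd <;> omega
    have := three_pow_lt_or_mod_nine t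
    obtain rfl : m = 4 := by omega
    exact hno 7 (isExcludingPrime_of_lt Nat.prime_seven (by omega) (by omega) (by omega)
      ⟨0, by omega, Or.inr (by omega)⟩)
  · obtain ⟨t, ht⟩ : ∃ t, m = 3 ^ t := by
      refine exists_eq_pow_of_forall_prime (by omega) fun p hp hd => ?_
      obtain rfl | rfl := h0 p hp hd <;> omega
    have := three_pow_lt_or_mod_nine t
    omega

lemma exists_isExcludingPrime_four_two (hm : 4 ≤ m) (hm6 : m ≠ 6) :
    ∃ p, IsExcludingPrime m 4 2 p := by
  by_contra! hno
  have h5 : m % 5 ≠ 0 := fun h => hno 5 (isExcludingPrime_four_two_five (by omega) h)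
  have h9 : ¬ (m % 3 ≤ 1 ∧ m / 3 % 3 ≤ 1) :=
    fun h => hno 3 (isExcludingPrime_four_two_three (by omega) h.1 h.2)
  have h0 : ∀ p : ℕ, p.Prime → p ∣ m → p = 2 ∨ p = 3 := by
    intro p hp hd
    obtain ⟨h1, rfl | rfl | rfl | rfl⟩ := prime_le_seven_cases_of_not hno (by omega) (by omega)
      (by omega) hp (i := 0) (by omega) (Or.inl hd) <;> omega
  have h1 : ∀ p : ℕ, p.Prime → p ∣ m - 1 → p = 2 ∨ p = 3 ∨ p = 5 := by
    intro p hp hd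
    obtain ⟨h1, rfl | rfl | rfl | rfl⟩ := prime_le_seven_cases_of_not hno (by omega) (by omega)
      (by omega) hp (i := 1) (by omega) (Or.inl hd) <;> omega
  rcases Nat.mod_two_eq_zero_or_one m with hpar | hpar
  · have hpow2 : m % 3 ≠ 0 → ∃ t, m = 2 ^ t := fun hm3 => by
      refine exists_eq_pow_of_forall_prime (by omega) fun p hp hd => ?_
      obtain rfl | rfl := h0 p hp hd <;> omega
    have hpow5 : m % 3 ≠ 1 → ∃ t, m - 1 = 5 ^ t := fun hm3 => by
      refine exists_eq_pow_of_forall_prime (by omega) fun p hp hd => ?_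
      obtain rfl | rfl | rfl := h1 p hp hd <;> omega
    obtain hm3 | hm3 | hm3 : m % 3 = 0 ∨ m % 3 = 1 ∨ m % 3 = 2 := by omega
    · obtain ⟨t, ht⟩ := hpow5 (by omega)
      have := five_pow_mod t
      -- Now m ≡ 6 modulo 24 and `h9` gives 9 ∤ m, so m / 6 is prime to 6; this would force m = 6.
      obtain ⟨p, hp, hd⟩ := Nat.exists_prime_and_dvd (show m / 6 ≠ 1 by omega)
      have hd' : p ∣ m := hd.trans (Nat.div_dvd_of_dvd (by omega))
      obtain rfl | rfl := h0 p hp hd' <;> omega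
    · by_cases hm5 : m % 5 = 1
      · obtain ⟨p, hp, hd⟩ := Nat.exists_prime_and_dvd (show m + 4 - 1 ≠ 1 by omega)
        obtain ⟨h1, rfl | rfl | rfl | rfl⟩ := prime_le_seven_cases_of_not hno (by omega)
          (by omega) (by omega) hp (i := 1) (by omega) (Or.inr hd) <;> omega
      · obtain ⟨t, ht⟩ : ∃ t, m - 1 = 3 ^ t := by
          refine exists_eq_pow_of_forall_prime (by omega) fun p hp hd => ?_
          obtain rfl | rfl | rfl := h1 p hp hd <;> omega
        have := three_pow_lt_or_mod_nine t
        clear hpow2 hpow5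
        omega
    · obtain ⟨t, ht⟩ := hpow2 (by omega)
      obtain ⟨s, hs⟩ := hpow5 (by omega)
      have := two_pow_lt_or_mod_eight t
      have := five_pow_mod s
      omega
  · obtain ⟨t, ht⟩ : ∃ t, m = 3 ^ t := by
      refine exists_eq_pow_of_forall_prime (by omega) fun p hp hd => ?_
      obtain rfl | rfl := h0 p hp hd <;> omega
    have := three_pow_lt_or_mod_nine t
    omega

/-- Only 2, 3, 5 could divide m, m - 1, m - 2; residues turn enough of these (or half of one) into
powers of a single prime, incompatible modulo 8, 9 or 24. -/
lemma exists_isExcludingPrime_four_three (hm : 7 ≤ m) : ∃ p, IsExcludingPrime m 4 3 p := by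
  by_contra! hno
  have h5 : m % 5 ≠ 0 := fun h => hno 5 (isExcludingPrime_four_three_five (by omega) h)
  have h7 : ¬ m % 7 ≤ 2 := fun h => hno 7 (isExcludingPrime_four_three_seven (by omega) h)
  have h0 : ∀ p : ℕ, p.Prime → p ∣ m → p = 2 ∨ p = 3 := by
    intro p hp hd
    obtain ⟨h1, rfl | rfl | rfl | rfl⟩ := prime_le_seven_cases_of_not hno (by omega) (by omega)
      (by omega) hp (i := 0) (by omega) (Or.inl hd) <;> omega
  have h1 : ∀ i < 3, ∀ p : ℕ, p.Prime → p ∣ m - i → p = 2 ∨ p = 3 ∨ p = 5 := by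
    intro i hi p hp hd
    obtain ⟨h1, rfl | rfl | rfl | rfl⟩ := prime_le_seven_cases_of_not hno (by omega) (by omega)
      (by omega) hp hi (Or.inl hd) <;> omega
  have hdvd5 : ∀ t n, n = 5 ^ t → n ≠ 1 → n % 5 = 0 := by
    rintro (_ | t) n rfl hn
    · simp at hn
    · rw [pow_succ]
      omega
  rcases Nat.mod_two_eq_zero_or_one m with hpar | hpar
  · have hpow5 : m % 3 ≠ 1 → ∃ t, m - 1 = 5 ^ t := fun hm3 => by
      refine exists_eq_pow_of_forall_prime (by omega) fun p hp hd => ?_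
      obtain rfl | rfl | rfl := h1 1 (by omega) p hp hd <;> omega
    by_cases hm3 : m % 3 = 0
    · obtain ⟨t, ht⟩ := hpow5 (by omega)
      have h51 := hdvd5 t _ ht (by omega)
      obtain ⟨s, hs⟩ : ∃ t, m - 2 = 2 ^ t := by
        refine exists_eq_pow_of_forall_prime (by omega) fun p hp hd => ?_
        obtain rfl | rfl | rfl := h1 2 (by omega) p hp hd <;> omega
      have := two_pow_lt_or_mod_eight s
      have := five_pow_mod t
      omega
    · obtain ⟨t, ht⟩ : ∃ t, m = 2 ^ t := by
        refine exists_eq_pow_of_forall_prime (by omega) fun p hp hd => ?_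
        obtain rfl | rfl := h0 p hp hd <;> omega
      have := two_pow_lt_or_mod_eight t
      by_cases hm1 : m % 3 = 1
      · obtain ⟨s, hs⟩ : ∃ t, (m - 2) / 2 = 5 ^ t := by
          refine exists_eq_pow_of_forall_prime (by omega) fun p hp hd => ?_
          have hd' : p ∣ m - 2 := hd.trans (Nat.div_dvd_of_dvd (by omega))
          obtain rfl | rfl | rfl := h1 2 (by omega) p hp hd' <;> omega
        have := five_pow_mod s
        omega
      · obtain ⟨s, hs⟩ := hpow5 hm1
        have := five_pow_mod s
        omega
  · obtain ⟨t, ht⟩ : ∃ t, m = 3 ^ t := by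
      refine exists_eq_pow_of_forall_prime (by omega) fun p hp hd => ?_
      obtain rfl | rfl := h0 p hp hd <;> omega
    have := three_pow_lt_or_mod_nine t
    obtain ⟨s, hs⟩ : ∃ t, m - 2 = 5 ^ t := by
      refine exists_eq_pow_of_forall_prime (by omega) fun p hp hd => ?_
      obtain rfl | rfl | rfl := h1 2 (by omega) p hp hd <;> omega
    have h52 := hdvd5 s _ hs (by omega)
    obtain ⟨r, hr⟩ : ∃ t, m - 1 = 2 ^ t := by
      refine exists_eq_pow_of_forall_prime (by omega) fun p hp hd => ?_
      obtain rfl | rfl | rfl := h1 1 (by omega) p hp hd <;> omega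
    have := two_pow_lt_or_mod_eight r
    have := five_pow_mod s
    omega

theorem exists_isExcludingPrime {a k : ℕ} (ha : a ≤ 4) (hk : 1 ≤ k) (hkm : 2 * k ≤ m)
    (h22 : ¬ (m = 2 ∧ a = 2)) (h44 : ¬ (m = 4 ∧ a = 4)) (h64 : ¬ (m = 6 ∧ a = 4)) :
    ∃ p, IsExcludingPrime m a k p := by
  by_cases hak : a ≤ k
  · exact exists_isExcludingPrime_of_le hk hkm hak
  obtain ⟨rfl, rfl⟩ | ⟨rfl, rfl⟩ | ⟨rfl, rfl⟩ | ⟨rfl, rfl⟩ | ⟨rfl, rfl⟩ | ⟨rfl, rfl⟩ :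
      (a = 2 ∧ k = 1) ∨ (a = 3 ∧ k = 1) ∨ (a = 4 ∧ k = 1) ∨ (a = 3 ∧ k = 2) ∨ (a = 4 ∧ k = 2) ∨
        (a = 4 ∧ k = 3) := by omega
  · exact exists_isExcludingPrime_two_one (by omega)
  · exact exists_isExcludingPrime_three_one (by omega)
  · exact exists_isExcludingPrime_four_one (by omega) (by omega)
  · exact exists_isExcludingPrime_three_two (by omega)
  · exact exists_isExcludingPrime_four_two (by omega) (by omega)
  · exact exists_isExcludingPrime_four_three (by omega)

end smallCases

theorem theorem1p2 (m : ℕ) (hm : 1 ≤ m) (α : ℚ) (hα : α ∈ ({0, 1, 2, 3, 4} : Set ℚ))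
    (φ : ℤ[X]) (hφ : φ.Monic)
    (hφirr : ∀ p : ℕ, p.Prime → (p : ℤ) ≤ (α.den : ℤ) * m + α.num →
      Irreducible (φ.map (Int.castRingHom (ZMod p))))
    (am : ℤ) (a : ℕ → ℤ[X])
    (ha : ∀ j < m, (a j).degree < φ.degree)
    (hcontent : ∀ p : ℕ, p.Prime → (p : ℤ) ≤ (α.den : ℤ) * m + α.num →
      ¬ (p : ℤ) ∣ (C am * a 0).content)
    (hexc : ((m : ℚ), α) ∉ ({(1, 0), (2, 2), (4, 4), (6, 4)} : Set (ℚ × ℚ))) :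
    Irreducible (phiLaguerre φ m α am a) := by
  obtain ⟨n, hn4, rfl⟩ : ∃ n : ℕ, n ≤ 4 ∧ α = n := by
    simp only [Set.mem_insert_iff, Set.mem_singleton_iff] at hα
    rcases hα with rfl | rfl | rfl | rfl | rfl
    exacts [⟨0, by norm_num⟩, ⟨1, by norm_num⟩, ⟨2, by norm_num⟩, ⟨3, by norm_num⟩, ⟨4, by norm_num⟩]
  have hle : ∀ p : ℕ, p ≤ m + n → (p : ℤ) ≤ ((n : ℚ).den : ℤ) * m + (n : ℚ).num := by
    intro p hp
    simp only [Rat.den_natCast, Rat.num_natCast]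
    push_cast
    omega
  simp only [Set.mem_insert_iff, Set.mem_singleton_iff, Prod.mk.injEq, not_or] at hexc
  norm_cast at hexc
  obtain ⟨h10, h22, h44, h64⟩ := hexc
  rw [phiLaguerre_natCast]
  have hunit : IsUnit (C ((1 : ℚ) / (m.factorial : ℚ))) := by
    rw [isUnit_C, isUnit_iff_ne_zero]
    have := Nat.factorial_ne_zero m
    positivity
  rw [irreducible_isUnit_mul hunit]
  -- Excluding (1, 0) gives m + α ≥ 2, hence a prime dividing m + α.
  refine irreducible_map_intLaguerre hm (by omega) hφ (fun p hp h => hφirr p hp (hle p h)) ha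
    (fun p hp h hd => hcontent p hp (hle p h) ?_) (fun p hp h h0 => hcontent p hp (hle p h) ?_)
    (fun k hk hkm => exists_isExcludingPrime hn4 hk hkm h22 h44 h64)
  · rw [content_C_mul]
    exact (dvd_normalize_iff.2 hd).mul_right _
  · rw [content_C_mul]
    refine Dvd.dvd.mul_left ?_ _
    rw [redMod_eq_zero_iff] at h0
    rw [dvd_content_iff_C_dvd]
    simpa using h0
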